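/- Let $K$ be a field complete with respect to a discrete valuation $v\colon K\to\mathbb{R}\cup\{\infty\}$ (so $v(K^\times)=c\,\mathbb{Z}$ with $c>0$, for example $c=1$), with residue field $k$ of characteristic $p>0$. Extend $v$ to an algebraic closure $K_{\rm alg}$ and to its completion $\mathbb{C}_K$. A disk is a set $D(a,r)=\{b\in\mathbb{C}_K : v(b-a)\ge r\}$ with $a\in\mathbb{C}_K$, $r\in\mathbb{R}\cup\{\infty\}$. A $K$-semivaluation on $K[z]$ is a map $V\colon K[z]\to\mathbb{R}\cup\{\infty\}$ extending $v$ with $V(gh)=V(g)+V(h)$ and $V(g+h)\ge\min(V(g),V(h))$; $\Lambda(V)$ is the residue field of the valuation it induces on the fraction field of $K[z]/\{g : V(g)=\infty\}$, and the ramification index of $V/v$ is the index of $v(K^\times)$ in the group generated by the finite values of $V$. Polynomials $a,b$ are $V$-equivalent if $a=b$ or $V(a-b)>V(a)$, and $\phi$ equivalence-divides $a$ if $a$ is $V$-equivalent to a multiple of $\phi$. A key polynomial for $V$ is a monic nonconstant $\phi$ such that if $\phi$ equivalence-divides a product then it equivalence-divides a factor, and every nonzero polynomial that it equivalence-divides has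 degree at least $\deg\phi$. For $f\in K[z]$ irreducible, $V_{f,\infty}(g)=v(g(\alpha))$, where $\alpha\in K_{\rm alg}$ is a root of $f$. Approximants to $V_{f,\infty}$ (MacLane) are $K$-semivaluations $V_1<\dots<V_n=V_{f,\infty}$, $n\ge1$, with key polynomials $\phi_i$ and key values $\mu_i\in\mathbb{R}\cup\{\infty\}$ such that: (i) $\phi_1=z-a$ for some $a\in K$, $-\mu_1$ is the unique slope of the lower convex hull of the points $(m,v(c_m))$, where $f=\sum_m c_m\phi_1^m$ with $c_m\in K$, and $V_1(\sum_m b_m\phi_1^m)=\min_m\,(v(b_m)+m\mu_1)$ for all $b_m\in K$; (ii) for $1\le i<n$: $\mu_i\neq\infty$; $\phi_{i+1}$ is a key polynomial for $V_i$ that lifts an irreducible factor $\psi$ of the image of $gf$ in the ring $R_i\subset\Lambda(V_i)$ of images of the polynomials $h$ with $V_i(h)\ge0$, for some $g$ with $\deg g<\deg\phi_i$ and $V_i(g)=-V_i(f)$ (``lifts'' means that $\psi$ is, up to a unit of $R_i$, the image of $g'\phi_{i+1}$ for some $g'$ with $\deg g'<\deg\phi_i$ and $V_i(g')=-V_i(\phi_{i+1})$);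 $-\mu_{i+1}$ is the unique slope of the lower convex hull of the points $(m,V_i(c_m))$, where $f=\sum_m c_m\phi_{i+1}^m$ with $\deg c_m<\deg\phi_{i+1}$; $\mu_{i+1}>V_i(\phi_{i+1})$; and $V_{i+1}(\sum_m b_m\phi_{i+1}^m)=\min_m\,(V_i(b_m)+m\mu_{i+1})$ whenever all $\deg b_m<\deg\phi_{i+1}$. A finite extension $L/K$ is weakly totally wildly ramified if its residue field extension is purely inseparable and its ramification index is a power of $p$ (possibly $p^0=1$). Theorem. Let $f\in K[z]$ be irreducible, let $B\subset\mathbb{C}_K$ be a disk containing the roots of $f$, and let $V_1<\dots<V_n=V_{f,\infty}$ be approximants to $V_{f,\infty}$ with key polynomials $\phi_1,\dots,\phi_n$. Let $j\le n$ be the largest index such that (1) the algebraic closure of $k$ in $\Lambda(V_j)$ is purely inseparable over $k$, and (2) the ramification index of $V_i/v$ is a power of $p$ for every $1\le i<j$. Then all roots of $\phi_j$ lie in $B$, and $\phi_j$ is irreducible and $K[z]/(\phi_j)$ is a weakly totally wildly ramified extension of $K$. -/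

import Mathlib

open Polynomial

namespace MacLane

noncomputable section

/-! ### Valuations attached to ultrametric norms -/

/-- The additive valuation `x ↦ -log ‖x‖`, with values in `ℝ ∪ {∞}`, of a field with an ultrametric
multiplicative norm. -/
def ordNorm (L : Type*) [NormedField L] [IsUltrametricDist L] : AddValuation L (WithTop ℝ) := by
  classical
  refine AddValuation.of (fun x => if x = 0 then ⊤ else ((-Real.log ‖x‖ : ℝ) : WithTop ℝ))
    (by simp) (by simp) ?_ ?_
  · intro x y
    by_cases hx : x = 0
    · simp [hx]
    by_cases hy : y = 0
    · simp [hy]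
    by_cases hxy : x + y = 0
    · simp [hxy]
    simp only [hx, hy, hxy, if_false]
    rw [← WithTop.coe_min, WithTop.coe_le_coe, min_neg_neg, neg_le_neg_iff]
    have h := IsUltrametricDist.norm_add_le_max x y
    rcases le_max_iff.1 h with h | h
    · exact le_max_of_le_left (Real.log_le_log (norm_pos_iff.2 hxy) h)
    · exact le_max_of_le_right (Real.log_le_log (norm_pos_iff.2 hxy) h)
  · intro x y
    by_cases hx : x = 0
    · simp [hx]
    by_cases hy : y = 0
    · simp [hy]
    simp only [hx, hy, mul_eq_zero, or_self, if_false, norm_mul]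
    rw [Real.log_mul (norm_ne_zero_iff.2 hx) (norm_ne_zero_iff.2 hy), neg_add, WithTop.coe_add]

theorem ordNorm_of_ne_zero {L : Type*} [NormedField L] [IsUltrametricDist L] {x : L} (hx : x ≠ 0) :
    ordNorm L x = ((-Real.log ‖x‖ : ℝ) : WithTop ℝ) :=
  if_neg hx

/-! ### `K`-semivaluations -/

/-- A `K`-semivaluation on a `K`-algebra `R`: a function `V : R → ℝ ∪ {∞}` with
`V (xy) = V x + V y` and `V (x + y) ≥ min (V x) (V y)` that restricts to the valuation of `K`. -/
structure KSemivaluation (K : Type*) [NormedField K] [IsUltrametricDist K]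
    (R : Type*) [CommRing R] [Algebra K R] where
  toAddValuation : AddValuation R (WithTop ℝ)
  map_algebraMap : ∀ a : K, toAddValuation (algebraMap K R a) = ordNorm K a

instance {K : Type*} [NormedField K] [IsUltrametricDist K] {R : Type*} [CommRing R] [Algebra K R] :
    CoeFun (KSemivaluation K R) (fun _ => R → WithTop ℝ) :=
  ⟨fun V => V.toAddValuation⟩

/-- The value group of a semivaluation: the subgroup of `ℝ` generated by its finite values. -/
def valueGroup {R : Type*} [CommRing R] (w : AddValuation R (WithTop ℝ)) : AddSubgroup ℝ :=
  AddSubgroup.closure {r : ℝ | ∃ x : R, w x = (r : WithTop ℝ)}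

/-- The ramification index of `V / v`, i.e. the index of the value group of `K` in that of `V`
(with value `0` if the index is infinite). -/
def ramificationIndex {K : Type*} [NormedField K] [IsUltrametricDist K] {R : Type*} [CommRing R]
    [Algebra K R] (V : KSemivaluation K R) : ℕ :=
  (valueGroup (ordNorm K)).relIndex (valueGroup V.toAddValuation)

/-- The valuation ring `{x | 0 ≤ w x}` of a valuation on a field. -/
def integers {F : Type*} [Field F] (w : AddValuation F (WithTop ℝ)) : ValuationSubring F :=
  (AddValuation.toValuation w).valuationSubring

theorem mem_integers {F : Type*} [Field F] (w : AddValuation F (WithTop ℝ)) (x : F) :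
    x ∈ integers w ↔ 0 ≤ w x := Iff.rfl

/-- The residue field of `K`. -/
abbrev BaseResidueField (K : Type*) [NormedField K] [IsUltrametricDist K] : Type _ :=
  IsLocalRing.ResidueField (integers (ordNorm K))

section

variable {K : Type*} [NormedField K] [IsUltrametricDist K]

/-- The residue field of a valuation on an extension field of `K` that extends the one of `K`. -/
def ResidueField {F : Type*} [Field F] [Algebra K F] (W : KSemivaluation K F) : Type _ :=
  IsLocalRing.ResidueField (integers W.toAddValuation)

instance {F : Type*} [Field F] [Algebra K F] (W : KSemivaluation K F) : Field (ResidueField W) :=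
  inferInstanceAs (Field (IsLocalRing.ResidueField (integers W.toAddValuation)))

/-- The inclusion of valuation rings `𝒪_K → 𝒪_F`. -/
def integersMap {F : Type*} [Field F] [Algebra K F] (W : KSemivaluation K F) :
    integers (ordNorm K) →+* integers W.toAddValuation :=
  ((algebraMap K F).comp (integers (ordNorm K)).subtype).codRestrict
    (integers W.toAddValuation) fun x => by
      rw [mem_integers]
      exact (W.map_algebraMap x).symm ▸ (mem_integers _ _).1 x.2

instance {F : Type*} [Field F] [Algebra K F] (W : KSemivaluation K F) :
    IsLocalHom (integersMap W) := by
  refine ⟨fun x hx => ?_⟩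
  obtain ⟨y, hy⟩ := hx.exists_right_inv
  have hy' : algebraMap K F x * (y : F) = 1 := congrArg Subtype.val hy
  have hx0 : (x : K) ≠ 0 := by
    intro h
    simp [h] at hy'
  have hinv : (x : K)⁻¹ ∈ integers (ordNorm K) := by
    rw [mem_integers, ← W.map_algebraMap, map_inv₀, inv_eq_of_mul_eq_one_right hy']
    exact (mem_integers _ _).1 y.2
  exact IsUnit.of_mul_eq_one (⟨(x : K)⁻¹, hinv⟩ : integers (ordNorm K))
    (Subtype.ext (mul_inv_cancel₀ hx0))

/-- The residue field of an extension is an extension of the residue field of `K`. -/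
instance {F : Type*} [Field F] [Algebra K F] (W : KSemivaluation K F) :
    Algebra (BaseResidueField K) (ResidueField W) :=
  RingHom.toAlgebra (S := IsLocalRing.ResidueField (integers W.toAddValuation))
    (IsLocalRing.ResidueField.map (integersMap W))

/-- The prime ideal `{g | V g = ∞}`. -/
abbrev supp {R : Type*} [CommRing R] [Algebra K R] (V : KSemivaluation K R) : Ideal R :=
  (AddValuation.toValuation V.toAddValuation).supp

/-- The field of fractions of `R / {g | V g = ∞}`. -/
abbrev FracField {R : Type*} [CommRing R] [Algebra K R] (V : KSemivaluation K R) : Type _ :=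
  FractionRing (R ⧸ supp V)

/-- The natural map from `R` to the field of fractions of `R / {g | V g = ∞}`. -/
def toFrac {R : Type*} [CommRing R] [Algebra K R] (V : KSemivaluation K R) : R →+* FracField V :=
  (algebraMap (R ⧸ supp V) (FracField V)).comp (Ideal.Quotient.mk (supp V))

theorem nonZeroDivisors_le {R : Type*} [CommRing R] [Algebra K R] (V : KSemivaluation K R) :
    nonZeroDivisors (R ⧸ supp V) ≤
      ((AddValuation.toValuation V.toAddValuation).onQuot
        (J := supp V) le_rfl).supp.primeCompl := by
  intro x hx
  rw [Ideal.mem_primeCompl_iff, Valuation.supp_quot_supp]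
  exact nonZeroDivisors.ne_zero hx

/-- The valuation that a semivaluation `V` on `R` induces on the field of fractions of
`R / {g | V g = ∞}`. -/
def fracAddValuation {R : Type*} [CommRing R] [Algebra K R] (V : KSemivaluation K R) :
    AddValuation (FracField V) (WithTop ℝ) :=
  AddValuation.ofValuation
    (((AddValuation.toValuation V.toAddValuation).onQuot (J := supp V) le_rfl).extendToLocalization
      (nonZeroDivisors_le V) (FracField V))

theorem fracAddValuation_toFrac {R : Type*} [CommRing R] [Algebra K R] (V : KSemivaluation K R)
    (g : R) : fracAddValuation V (toFrac V g) = V g :=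
  Valuation.extendToLocalization_apply_map_apply
    ((AddValuation.toValuation V.toAddValuation).onQuot (J := supp V) le_rfl)
    (nonZeroDivisors_le V) (FracField V) (Ideal.Quotient.mk (supp V) g)

/-- The induced valuation on the field of fractions, as a valuation extending that of `K`. -/
def frac {R : Type*} [CommRing R] [Algebra K R] (V : KSemivaluation K R) :
    KSemivaluation K (FracField V) where
  toAddValuation := fracAddValuation V
  map_algebraMap a := by
    rw [← V.map_algebraMap a, ← fracAddValuation_toFrac]
    rfl

/-- The residue class field `Λ(V)` of a semivaluation `V`. -/
abbrev Lam {R : Type*} [CommRing R] [Algebra K R] (V : KSemivaluation K R) : Type _ :=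
  ResidueField (frac V)

/-- The ring of all `g` with `0 ≤ V g`. -/
def integerRing {R : Type*} [CommRing R] [Algebra K R] (V : KSemivaluation K R) : Subring R :=
  (AddValuation.toValuation V.toAddValuation).integer

theorem mem_integerRing {R : Type*} [CommRing R] [Algebra K R] (V : KSemivaluation K R) (g : R) :
    g ∈ integerRing V ↔ 0 ≤ V g := Iff.rfl

/-- Reduction of the elements `g` with `0 ≤ V g` to the residue class field of `V`. -/
def reduction {R : Type*} [CommRing R] [Algebra K R] (V : KSemivaluation K R) :
    integerRing V →+* Lam V :=
  (IsLocalRing.residue (integers (fracAddValuation V))).comp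
    (((toFrac V).comp (integerRing V).subtype).codRestrict
      (integers (fracAddValuation V)) fun g => by
        rw [mem_integers]
        exact (fracAddValuation_toFrac V g).symm ▸ (mem_integerRing V g).1 g.2)

/-! ### MacLane's inductive semivaluations -/

/-- `V`-equivalence of polynomials. -/
def Equivalent (V : KSemivaluation K K[X]) (a b : K[X]) : Prop :=
  a = b ∨ V a < V (a - b)

/-- `φ` divides `a` up to `V`-equivalence. -/
def EquivDvd (V : KSemivaluation K K[X]) (φ a : K[X]) : Prop :=
  ∃ c : K[X], Equivalent V a (c * φ)

/-- Key polynomials for `V`: monic nonconstant polynomials that are equivalence irreducible and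
minimal. -/
structure IsKeyPolynomial (V : KSemivaluation K K[X]) (φ : K[X]) : Prop where
  monic : φ.Monic
  natDegree_pos : 0 < φ.natDegree
  irreducible : ∀ a b : K[X], EquivDvd V φ (a * b) → EquivDvd V φ a ∨ EquivDvd V φ b
  minimal : ∀ a : K[X], a ≠ 0 → EquivDvd V φ a → φ.natDegree ≤ a.natDegree

/-- The coefficient `c_m` in the expansion `g = ∑ c_m φ^m` with `deg c_m < deg φ`, for `φ` monic and
nonconstant. -/
def digit (φ g : K[X]) (m : ℕ) : K[X] := (g /ₘ φ ^ m) %ₘ φ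

/-- `min_m (w (c_m) + m μ)`, where `g = ∑ c_m φ^m` is the `φ`-adic expansion of `g` (all `c_m` with
`m > deg g` vanish). -/
def expansionMin (w : K[X] → WithTop ℝ) (φ : K[X]) (μ : WithTop ℝ) (g : K[X]) : WithTop ℝ :=
  (Finset.range (g.natDegree + 1)).inf fun m => w (digit φ g m) + m • μ

/-- `V = [v, V (z - a) = μ]`. -/
def IsFirstStage (a : K) (μ : WithTop ℝ) (V : KSemivaluation K K[X]) : Prop :=
  ∀ g : K[X], V g = expansionMin (fun c => ordNorm K (c.coeff 0)) (X - C a) μ g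

/-- `V' = [V, V' φ = μ]` is an augmentation of `V`. -/
structure IsAugmentation (V : KSemivaluation K K[X]) (φ : K[X]) (μ : WithTop ℝ)
    (V' : KSemivaluation K K[X]) : Prop where
  isKeyPolynomial : IsKeyPolynomial V φ
  lt : V φ < μ
  eq : ∀ g : K[X], V' g = expansionMin V φ μ g

/-- Write `f = ∑_{j ≤ N} c_j φ^j` for the `φ`-adic expansion of `f`, with `N = ⌊deg f / deg φ⌋`. The
lower convex hull of the points `(j, w (c_j))` has a unique slope, namely `-μ`; that is, `N ≥ 1`, the
segment of slope `-μ` through `(0, w (c_0))` ends at `(N, w (c_N))`, and no point lies below it. The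
case `μ = ∞` is the case `w (c_0) = ∞`. -/
def IsNewtonKeyValue (w : K[X] → WithTop ℝ) (φ f : K[X]) (μ : WithTop ℝ) : Prop :=
  1 ≤ f.natDegree / φ.natDegree ∧
  w (digit φ f 0) =
    w (digit φ f (f.natDegree / φ.natDegree)) + (f.natDegree / φ.natDegree) • μ ∧
  ∀ j ≤ f.natDegree / φ.natDegree, w (digit φ f 0) ≤ w (digit φ f j) + j • μ

/-- `φ'` lifts an irreducible factor of the reduction of `f` at `V`, where `V` has key polynomial `φ`:
there are `g` of degree `< deg φ` with `V g = - V f` and an irreducible polynomial factor `ψ` of the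
image of `g f` in the residue class field `Λ(V)`, such that `ψ` is, up to a unit, the image of `g' φ'`
for some `g'` of degree `< deg φ` with `V g' = - V φ'`. Here the ring of images in `Λ(V)` of the
polynomials with nonnegative value plays the role of the polynomial ring `k_V[y]` inside
`Λ(V) = k_V(y)`. -/
def IsLiftOfFactor (V : KSemivaluation K K[X]) (φ f φ' : K[X]) : Prop :=
  ∃ g g' : K[X], g.natDegree < φ.natDegree ∧ V g + V f = 0 ∧
    g'.natDegree < φ.natDegree ∧ V g' + V φ' = 0 ∧
    ∃ F F' : integerRing V, (F : K[X]) = g * f ∧ (F' : K[X]) = g' * φ' ∧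
      ∃ ψ : (reduction V).range, Irreducible ψ ∧ ψ ∣ (reduction V).rangeRestrict F ∧
        Associated ψ ((reduction V).rangeRestrict F')

end

/-! ### The algebraic closure, its completion, and finite extensions -/

section

variable (K : Type*) [NontriviallyNormedField K] [IsUltrametricDist K] [CompleteSpace K]

/-- The unique extension of the valuation of the complete field `K` to an algebraic extension `L`,
given by the spectral norm. -/
def extendedValuation (L : Type*) [Field L] [Algebra K L] [Algebra.IsAlgebraic K L] :
    KSemivaluation K L :=
  letI : NormedField L := spectralNorm.normedField K L
  haveI : IsUltrametricDist L :=
    IsUltrametricDist.isUltrametricDist_of_forall_norm_add_le_max_norm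
      (isNonarchimedean_spectralNorm (K := K) (L := L))
  { toAddValuation := ordNorm L
    map_algebraMap := fun a => by
      by_cases ha : a = 0
      · simp [ha]
      have h : ‖algebraMap K L a‖ = ‖a‖ := spectralNorm_extends a
      rw [ordNorm_of_ne_zero ha,
        ordNorm_of_ne_zero ((map_ne_zero_iff _ (algebraMap K L).injective).2 ha), h] }

/-- The norm of the algebraic closure of `K` that extends the norm of `K`. -/
instance : NormedField (AlgebraicClosure K) := spectralNorm.normedField K (AlgebraicClosure K)

instance : IsUltrametricDist (AlgebraicClosure K) :=
  IsUltrametricDist.isUltrametricDist_of_forall_norm_add_le_max_norm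
    (isNonarchimedean_spectralNorm (K := K) (L := AlgebraicClosure K))

/-- `ℂ_K`, the completion of the algebraic closure of `K`. -/
abbrev CompletedClosure : Type _ := UniformSpace.Completion (AlgebraicClosure K)

instance : IsUltrametricDist (CompletedClosure K) := by
  refine IsUltrametricDist.isUltrametricDist_of_forall_norm_add_le_max_norm fun x y => ?_
  induction x, y using UniformSpace.Completion.induction_on₂ with
  | hp => exact isClosed_le (by fun_prop) (by fun_prop)
  | ih a b =>
    rw [← UniformSpace.Completion.coe_add]
    simp only [UniformSpace.Completion.norm_coe]
    exact IsUltrametricDist.norm_add_le_max a b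

variable {K}

/-- The disk `D(a, r)` in `ℂ_K`, with `r ∈ ℝ ∪ {∞}`. -/
def disk (a : CompletedClosure K) (r : WithTop ℝ) : Set (CompletedClosure K) :=
  {b | r ≤ ordNorm (CompletedClosure K) (b - a)}

/-- `V = V_{f,∞}`, that is, `V g = v (g α)` for a root `α` of the irreducible polynomial `f` (the
choice of the root does not matter). -/
def IsSemivaluationAtInfinity (f : K[X]) (V : KSemivaluation K K[X]) : Prop :=
  ∃ α : AlgebraicClosure K, aeval α f = 0 ∧
    ∀ g : K[X], V g = extendedValuation K (AlgebraicClosure K) (aeval α g)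

/-- `V 1, …, V n = V_{f,∞}` is a sequence of approximants to `V_{f,∞}` obtained by MacLane's method,
with key polynomials `φ 1, …, φ n` and key values `μ 1, …, μ n`. -/
structure IsApproximants (f : K[X]) (n : ℕ) (V : ℕ → KSemivaluation K K[X]) (φ : ℕ → K[X])
    (μ : ℕ → WithTop ℝ) : Prop where
  one_le : 1 ≤ n
  first : ∃ a : K, φ 1 = X - C a ∧ IsFirstStage a (μ 1) (V 1)
  first_keyValue : IsNewtonKeyValue (fun c => ordNorm K (c.coeff 0)) (φ 1) f (μ 1)
  ne_top : ∀ i, 1 ≤ i → i < n → μ i ≠ ⊤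
  isLift : ∀ i, 1 ≤ i → i < n → IsLiftOfFactor (V i) (φ i) f (φ (i + 1))
  keyValue : ∀ i, 1 ≤ i → i < n → IsNewtonKeyValue (V i) (φ (i + 1)) f (μ (i + 1))
  isAugmentation : ∀ i, 1 ≤ i → i < n →
    IsAugmentation (V i) (φ (i + 1)) (μ (i + 1)) (V (i + 1))
  last : IsSemivaluationAtInfinity f (V n)

variable (K)

/-- A finite extension `L / K` is weakly totally ramified if its residue field extension is purely
inseparable, and weakly totally wildly ramified if moreover its ramification index is a power of
the residue characteristic of `K` (with `0 ^ 0 = 1`). -/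
structure IsWeaklyTotallyWildlyRamified (L : Type*) [Field L] [Algebra K L]
    [Algebra.IsAlgebraic K L] : Prop where
  finiteDimensional : FiniteDimensional K L
  purelyInseparable :
    IsPurelyInseparable (BaseResidueField K) (ResidueField (extendedValuation K L))
  ramificationIndex_eq :
    ∃ m : ℕ, ramificationIndex (extendedValuation K L) = ringChar (BaseResidueField K) ^ m

end

end

end MacLane

namespace MacLane

noncomputable section

/-! ### Digits of `φ`-adic expansions -/

section Digits

variable {K : Type*} [NormedField K]

/-! Write `k` for the residue field of `K`. The assertions about `K[z]/(φ_j)` rest on an intrinsic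
description of a stage `V` with key polynomial `φ`. Taking remainders of degree below `deg φ` turns
`V` into a valuation of the field `K[z]/(φ)`. By completeness it is the only extension of `v`. Its
residue field embeds in `Λ(V)` with image the algebraic closure of `k`
(`IsStage.mem_range_lamHom_of_isAlgebraic`), so condition (1) speaks of the residue extension of
`K[z]/(φ_j)`. Its values are values of `V_{j-1}`, so condition (2) bounds its ramification
(`ramificationIndex_dvd`).

For the roots, the case `j = n` is clear because `φ_n` divides `f`. Let `j < n` and suppose that
some root of `φ_j` lies outside `B`. Fix a root `α` of `f`. As `B` is a disk containing all
conjugates of `α`, each conjugate is closer to `α` than any root of `φ_j` is. A nonzero `g` with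
`deg g < deg φ_j` has the same absolute value at `α` and at the roots of `φ_j`, which forces its
roots away from `α` too (`norm_sub_lt_of_root`). Hence `x = g(α) φ_j(α)^m` is almost Galois
invariant: `‖σ x - x‖ < ‖x‖` for all `σ`.

For such an `x` the minimal polynomial is close to a power of `X - x`. A coefficient whose binomial
factor is prime to `p` shows that some `x^(p^k)` is close to an element of `K`
(`exists_norm_pow_sub_lt`). Applied to elements of value `0`, this makes the residue field of
`K[z]/(φ_{j+1})` purely inseparable over `k`; applied to arbitrary values, it makes the ramification
index of `V_j` a power of `p`. So `j + 1` also satisfies (1) and (2), against the maximality of `j`.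
-/

theorem digit_zero_right (φ g : K[X]) : digit φ g 0 = g %ₘ φ := by
  simp [digit]

theorem digit_zero_left (φ : K[X]) (m : ℕ) : digit φ 0 m = 0 := by
  simp [digit]

theorem degree_digit_lt {φ : K[X]} (hφ : φ.Monic) (g : K[X]) (m : ℕ) :
    (digit φ g m).degree < φ.degree :=
  degree_modByMonic_lt _ hφ

theorem divByMonic_pow_succ {φ : K[X]} (hφ : φ.Monic) (g : K[X]) (m : ℕ) :
    g /ₘ φ ^ (m + 1) = (g /ₘ φ ^ m) /ₘ φ := by
  refine (div_modByMonic_unique (g /ₘ φ ^ m /ₘ φ) (g %ₘ φ ^ m + φ ^ m * ((g /ₘ φ ^ m) %ₘ φ))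
    (hφ.pow (m + 1)) ⟨?_, ?_⟩).1
  · have h1 := modByMonic_add_div (g /ₘ φ ^ m) φ
    have h2 := modByMonic_add_div g (φ ^ m)
    linear_combination h2 + φ ^ m * h1
  · have h1 : (g %ₘ φ ^ m).degree < (φ ^ m).degree := degree_modByMonic_lt _ (hφ.pow m)
    have h2 : ((g /ₘ φ ^ m) %ₘ φ).degree < φ.degree := degree_modByMonic_lt _ hφ
    have h3 : (φ ^ m).degree ≤ (φ ^ (m + 1)).degree :=
      degree_le_of_dvd (pow_dvd_pow φ (Nat.le_succ m)) (hφ.pow _).ne_zero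
    refine (degree_add_le _ _).trans_lt (max_lt (h1.trans_le h3) ?_)
    rw [pow_succ, degree_mul, degree_mul]
    exact WithBot.add_lt_add_left (degree_ne_bot.2 (hφ.pow m).ne_zero) h2

theorem divByMonic_pow_eq_zero {φ : K[X]} (hφ : φ.Monic) {g : K[X]} {m : ℕ}
    (h : g.natDegree < m * φ.natDegree) : g /ₘ φ ^ m = 0 := by
  rw [(divByMonic_eq_zero_iff (hφ.pow m)).2]
  apply degree_lt_degree
  rwa [hφ.natDegree_pow]

theorem digit_eq_zero {φ : K[X]} (hφ : φ.Monic) {g : K[X]} {m : ℕ}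
    (h : g.natDegree < m * φ.natDegree) : digit φ g m = 0 := by
  rw [digit, divByMonic_pow_eq_zero hφ h, zero_modByMonic]

theorem sum_digit_add {φ : K[X]} (hφ : φ.Monic) (g : K[X]) (m : ℕ) :
    ∑ i ∈ Finset.range m, digit φ g i * φ ^ i + (g /ₘ φ ^ m) * φ ^ m = g := by
  induction m with
  | zero => simp
  | succ m ih =>
    rw [Finset.sum_range_succ, divByMonic_pow_succ hφ]
    conv_rhs => rw [← ih]
    have := modByMonic_add_div (g /ₘ φ ^ m) φ
    rw [digit]
    linear_combination φ ^ m * this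

theorem sum_digit {φ : K[X]} (hφ : φ.Monic) {g : K[X]} {m : ℕ}
    (h : g.natDegree < m * φ.natDegree) :
    ∑ i ∈ Finset.range m, digit φ g i * φ ^ i = g := by
  conv_rhs => rw [← sum_digit_add hφ g m, divByMonic_pow_eq_zero hφ h, zero_mul, add_zero]

theorem sum_digit_natDegree {φ : K[X]} (hφ : φ.Monic) (hd : 0 < φ.natDegree) (g : K[X]) :
    ∑ i ∈ Finset.range (g.natDegree + 1), digit φ g i * φ ^ i = g :=
  sum_digit hφ (by nlinarith)

theorem digit_zero_of_degree_lt {φ c : K[X]} (hφ : φ.Monic) (h : c.degree < φ.degree) :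
    digit φ c 0 = c := by
  rw [digit_zero_right, (modByMonic_eq_self_iff hφ).2 h]

theorem digit_of_degree_lt {φ c : K[X]} (hφ : φ.Monic) (h : c.degree < φ.degree) {m : ℕ}
    (hm : m ≠ 0) : digit φ c m = 0 := by
  by_cases hc : c = 0
  · rw [hc, digit_zero_left]
  apply digit_eq_zero hφ
  have := natDegree_lt_natDegree hc h
  nlinarith [Nat.pos_of_ne_zero hm]

end Digits

/-! ### The minimum over a `φ`-adic expansion -/

section Expansion

variable {K : Type*} [NormedField K]

theorem expansionMin_le {w : K[X] → WithTop ℝ} (hw : w 0 = ⊤) {φ : K[X]} (hφ : φ.Monic)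
    (hd : 0 < φ.natDegree) (μ : WithTop ℝ) (g : K[X]) (m : ℕ) :
    expansionMin w φ μ g ≤ w (digit φ g m) + m • μ := by
  by_cases hm : m ≤ g.natDegree
  · exact Finset.inf_le (f := fun m : ℕ => w (digit φ g m) + m • μ)
      (Finset.mem_range_succ_iff.2 hm)
  · rw [digit_eq_zero hφ (by nlinarith), hw, WithTop.top_add]
    exact le_top

theorem expansionMin_congr {w w' : K[X] → WithTop ℝ} {φ : K[X]} (hφ : φ.Monic)
    (h : ∀ c : K[X], c.degree < φ.degree → w c = w' c) (μ : WithTop ℝ) (g : K[X]) :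
    expansionMin w φ μ g = expansionMin w' φ μ g :=
  Finset.inf_congr rfl fun m _ => by rw [h _ (degree_digit_lt hφ g m)]

theorem expansionMin_of_degree_lt {w : K[X] → WithTop ℝ} (hw : w 0 = ⊤) {φ c : K[X]}
    (hφ : φ.Monic) (hd : 0 < φ.natDegree) (μ : WithTop ℝ) (hc : c.degree < φ.degree) :
    expansionMin w φ μ c = w c := by
  refine le_antisymm ?_ (Finset.le_inf fun m _ => ?_)
  · simpa [digit_zero_of_degree_lt hφ hc] using expansionMin_le hw hφ hd μ c 0
  · by_cases hm : m = 0
    · subst hm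
      simp [digit_zero_of_degree_lt hφ hc]
    · simp [digit_of_degree_lt hφ hc hm, hw]

theorem expansionMin_self {w : K[X] → WithTop ℝ} (hw : w 0 = ⊤) (hw' : w 1 = 0) {φ : K[X]}
    (hφ : φ.Monic) (hd : 0 < φ.natDegree) (μ : WithTop ℝ) : expansionMin w φ μ φ = μ := by
  have h1 : φ /ₘ φ = 1 := by
    simpa using mul_divByMonic_cancel_left 1 hφ
  have h2 : (1 : K[X]).degree < φ.degree := by
    rw [degree_one]
    exact natDegree_pos_iff_degree_pos.1 hd
  have hdig : digit φ φ 1 = 1 := by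
    rw [digit, pow_one, h1, (modByMonic_eq_self_iff hφ).2 h2]
  apply le_antisymm
  · simpa [hdig, hw'] using expansionMin_le hw hφ hd μ φ 1
  · refine Finset.le_inf fun m _ => ?_
    by_cases hm : m = 1
    · subst hm
      simp [hdig, hw']
    · have : digit φ φ m = 0 := by
        rcases Nat.eq_zero_or_pos m with rfl | hm'
        · rw [digit_zero_right, modByMonic_self hφ]
        · exact digit_eq_zero hφ (by nlinarith [(by omega : 2 ≤ m)])
      simp [this, hw]

theorem eq_C_of_degree_lt_X_sub_C {a : K} {c : K[X]} (hc : c.degree < (X - C a).degree) :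
    c = C (c.coeff 0) := by
  rw [degree_X_sub_C] at hc
  exact eq_C_of_degree_le_zero (Nat.WithBot.lt_one_iff_le_zero.1 hc)

end Expansion

/-! ### Stages, and their stability under augmentation -/

section Stage

variable {K : Type*} [NormedField K] [IsUltrametricDist K]

/-- The properties of a stage `V` with key polynomial `φ` and key value `μ` of MacLane's inductive
construction that do not refer to the previous stages. -/
structure IsStage (V : KSemivaluation K K[X]) (φ : K[X]) (μ : WithTop ℝ) : Prop where
  monic : φ.Monic
  natDegree_pos : 0 < φ.natDegree
  eq : ∀ g : K[X], V g = expansionMin V φ μ g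
  ne_top : ∀ a : K[X], a ≠ 0 → a.degree < φ.degree → V a ≠ ⊤
  lt_sub_modByMonic : ∀ a b : K[X], a ≠ 0 → b ≠ 0 → a.degree < φ.degree → b.degree < φ.degree →
    V (a * b) < V (a * b - (a * b) %ₘ φ)

theorem KSemivaluation.map_C (V : KSemivaluation K K[X]) (a : K) : V (C a) = ordNorm K a :=
  V.map_algebraMap a

theorem KSemivaluation.apply_of_degree_lt_X_sub_C (V : KSemivaluation K K[X]) {a : K} {c : K[X]}
    (hc : c.degree < (X - C a).degree) : V c = ordNorm K (c.coeff 0) := by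
  conv_lhs => rw [eq_C_of_degree_lt_X_sub_C hc]
  exact V.map_C _

theorem IsFirstStage.isStage {V : KSemivaluation K K[X]} {a : K} {μ : WithTop ℝ}
    (h : IsFirstStage a μ V) : IsStage V (X - C a) μ where
  monic := monic_X_sub_C a
  natDegree_pos := by simp
  eq g := by
    rw [h g]
    exact expansionMin_congr (monic_X_sub_C a)
      (fun c hc => (V.apply_of_degree_lt_X_sub_C hc).symm) μ g
  ne_top c hc0 hc := by
    rw [V.apply_of_degree_lt_X_sub_C hc, AddValuation.ne_top_iff]
    intro h0
    rw [eq_C_of_degree_lt_X_sub_C hc, h0, C_0] at hc0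
    exact hc0 rfl
  lt_sub_modByMonic b c hb0 hc0 hb hc := by
    rw [eq_C_of_degree_lt_X_sub_C hb] at hb0 ⊢
    rw [eq_C_of_degree_lt_X_sub_C hc] at hc0 ⊢
    rw [← C_mul, (modByMonic_eq_self_iff (monic_X_sub_C a)).2, sub_self, AddValuation.map_zero, V.map_C,
      lt_top_iff_ne_top, AddValuation.ne_top_iff]
    · rw [Ne, C_eq_zero] at hb0 hc0
      exact mul_ne_zero hb0 hc0
    · rw [degree_X_sub_C]
      exact degree_C_le.trans_lt (by norm_num)

namespace IsStage

variable {V V' : KSemivaluation K K[X]} {φ φ' : K[X]} {μ μ' : WithTop ℝ}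

theorem le_digit (h : IsStage V φ μ) (g : K[X]) (m : ℕ) : V g ≤ V (digit φ g m) + m • μ := by
  rw [h.eq g]
  exact expansionMin_le (AddValuation.map_zero _) h.monic h.natDegree_pos μ g m

theorem le_modByMonic (h : IsStage V φ μ) (g : K[X]) : V g ≤ V (g %ₘ φ) := by
  simpa [digit_zero_right] using h.le_digit g 0

theorem exists_eq_digit (h : IsStage V φ μ) (g : K[X]) :
    ∃ m : ℕ, V g = V (digit φ g m) + m • μ := by
  obtain ⟨m, -, hm⟩ := Finset.exists_mem_eq_inf (Finset.range (g.natDegree + 1)) ⟨0, by simp⟩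
    fun m : ℕ => V (digit φ g m) + m • μ
  exact ⟨m, (h.eq g).trans hm⟩

theorem map_key (h : IsStage V φ μ) : V φ = μ := by
  rw [h.eq, expansionMin_self (AddValuation.map_zero _) (AddValuation.map_one _) h.monic
    h.natDegree_pos]

theorem ne_top_of_ne_zero (h : IsStage V φ μ) (hμ : μ ≠ ⊤) {g : K[X]} (hg : g ≠ 0) : V g ≠ ⊤ := by
  intro htop
  apply hg
  rw [← sum_digit_natDegree h.monic h.natDegree_pos g]
  refine Finset.sum_eq_zero fun m _ => ?_
  by_contra h0
  have h1 := h.le_digit g m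
  rw [htop, top_le_iff, WithTop.add_eq_top] at h1
  rcases h1 with h1 | h1
  · exact h.ne_top _ (fun h2 => h0 (by rw [h2, zero_mul])) (degree_digit_lt h.monic g m) h1
  · lift μ to ℝ using hμ
    rw [← WithTop.coe_nsmul] at h1
    exact WithTop.coe_ne_top h1

/-- If `φ = a b` with factors of smaller degree, the remainder of `a b` is zero, and
`lt_sub_modByMonic` would read `V φ < V φ`. -/
theorem irreducible (h : IsStage V φ μ) : Irreducible φ := by
  have h1 : φ ≠ 1 := by
    rintro rfl
    simpa using h.natDegree_pos
  rw [h.monic.irreducible_iff_natDegree']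
  refine ⟨h1, fun a b ha hb hab hmem => ?_⟩
  rw [Finset.mem_Ioc] at hmem
  have hdeg : a.natDegree + b.natDegree = φ.natDegree := by rw [← hab, ha.natDegree_mul hb]
  have hlt : ∀ c : K[X], c.natDegree < φ.natDegree → c.degree < φ.degree :=
    fun c hc => degree_lt_degree hc
  have := h.lt_sub_modByMonic a b ha.ne_zero hb.ne_zero (hlt a (by omega)) (hlt b (by omega))
  rw [hab, modByMonic_self h.monic, sub_zero] at this
  exact this.false

/-- This is division in the field `K[X]/(φ)`, by a Bézout relation between `φ` and `a`. -/
theorem exists_mul_modByMonic_eq (h : IsStage V φ μ) {a b : K[X]} (ha : a ≠ 0)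
    (hda : a.degree < φ.degree) (hdb : b.degree < φ.degree) :
    ∃ s : K[X], s.degree < φ.degree ∧ (s * a) %ₘ φ = b := by
  have hndvd : ¬ φ ∣ a := fun hdvd => (degree_le_of_dvd hdvd ha).not_gt hda
  obtain ⟨u, v, huv⟩ := (EuclideanDomain.dvd_or_coprime φ a h.irreducible).resolve_left hndvd
  refine ⟨(b * v) %ₘ φ, degree_modByMonic_lt _ h.monic, ?_⟩
  have h1 := modByMonic_add_div (b * v) φ
  have h2 : b * v %ₘ φ * a = b + φ * (- (b * u) - (b * v /ₘ φ) * a) := by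
    linear_combination a * h1 + b * huv
  rw [h2, add_modByMonic, (modByMonic_eq_self_iff h.monic).2 hdb,
    (modByMonic_eq_zero_iff_dvd h.monic).2 (dvd_mul_right _ _), add_zero]

/-- The part of `a * b` divisible by `φ` has strictly larger value, so dropping it changes nothing.
This is what makes `V` multiplicative on remainders, hence a valuation of `K[X]/(φ)`. -/
theorem map_mul_modByMonic (h : IsStage V φ μ) {a b : K[X]} (ha : a.degree < φ.degree)
    (hb : b.degree < φ.degree) : V ((a * b) %ₘ φ) = V a + V b := by
  rw [← AddValuation.map_mul]
  by_cases ha0 : a = 0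
  · simp [ha0]
  by_cases hb0 : b = 0
  · simp [hb0]
  have := h.lt_sub_modByMonic a b ha0 hb0 ha hb
  rw [AddValuation.map_sub_swap] at this
  exact AddValuation.map_eq_of_lt_sub _ this

/-- The degrees of the key polynomials of successive stages increase. -/
theorem degree_le_of_isKeyPolynomial (h : IsStage V φ μ) (h' : IsKeyPolynomial V φ') :
    φ.degree ≤ φ'.degree := by
  by_contra! hlt
  have h1 : (1 : K[X]).degree < φ.degree := by
    rw [degree_one]
    exact natDegree_pos_iff_degree_pos.1 h.natDegree_pos
  obtain ⟨s, hs, hs1⟩ := h.exists_mul_modByMonic_eq h'.monic.ne_zero hlt h1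
  have hs0 : s ≠ 0 := by
    rintro rfl
    simp at hs1
  -- A key polynomial of degree below `deg φ` has an inverse `s` modulo `φ`. Then `1` is
  -- `V`-equivalent to `s * φ'`, so `φ'` equivalence-divides `1`, against minimality.
  have h2 := h.lt_sub_modByMonic s φ' hs0 h'.monic.ne_zero hs hlt
  rw [hs1] at h2
  have h3 : V 1 = V (s * φ') := by
    rw [AddValuation.map_sub_swap] at h2
    exact AddValuation.map_eq_of_lt_sub _ h2
  rw [← h3, AddValuation.map_sub_swap] at h2
  have h4 := h'.minimal 1 one_ne_zero ⟨s, Or.inr h2⟩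
  have := h'.natDegree_pos
  simp at h4
  omega

/-- Write `a b = r + φ' q`. Since `φ'` equivalence-divides neither `a` nor `b`, no cancellation
makes `V r` exceed `V (a b)`. Conversely `V r ≥ V (a b)`, so `V (φ' q) ≥ V (a b)`, and raising the
value of `φ'` from `V φ'` to `μ'` makes the inequality strict. -/
theorem isAugmentation (h : IsStage V φ μ) (hμ : μ ≠ ⊤) (h' : IsAugmentation V φ' μ' V') :
    IsStage V' φ' μ' ∧ ∀ c : K[X], c.degree < φ'.degree → V' c = V c := by
  have hm := h'.isKeyPolynomial.monic
  have hd := h'.isKeyPolynomial.natDegree_pos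
  have hlow : ∀ c : K[X], c.degree < φ'.degree → V' c = V c := fun c hc => by
    rw [h'.eq, expansionMin_of_degree_lt (AddValuation.map_zero _) hm hd μ' hc]
  refine ⟨⟨hm, hd, fun g => ?_, fun a ha hda => ?_, fun a b ha hb hda hdb => ?_⟩, hlow⟩
  · rw [h'.eq g]
    exact expansionMin_congr hm (fun c hc => (hlow c hc).symm) μ' g
  · rw [hlow a hda]
    exact h.ne_top_of_ne_zero hμ ha
  have hab0 : a * b ≠ 0 := mul_ne_zero ha hb
  have hab : V' (a * b) = V (a * b) := by
    rw [AddValuation.map_mul, AddValuation.map_mul, hlow a hda, hlow b hdb]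
  have hfin := h.ne_top_of_ne_zero hμ hab0
  set q := (a * b) /ₘ φ' with hq
  set r := (a * b) %ₘ φ' with hr
  have hqr : r + φ' * q = a * b := modByMonic_add_div _ _
  have hr1 : V r ≤ V (a * b) := by
    by_contra! hlt
    have hdvd : EquivDvd V φ' (a * b) := by
      refine ⟨q, Or.inr ?_⟩
      rwa [← hqr, mul_comm φ' q, add_sub_cancel_right, mul_comm q φ', hqr]
    rcases h'.isKeyPolynomial.irreducible a b hdvd with hdvd | hdvd
    · exact (h'.isKeyPolynomial.minimal a ha hdvd).not_gt (natDegree_lt_natDegree ha hda)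
    · exact (h'.isKeyPolynomial.minimal b hb hdvd).not_gt (natDegree_lt_natDegree hb hdb)
  have hr2 : V (a * b) ≤ V r := by
    rw [← hab, h'.eq]
    simpa [digit_zero_right] using expansionMin_le (w := V) (AddValuation.map_zero _) hm hd μ' (a * b) 0
  have hsub : a * b - r = φ' * q := by rw [← hqr]; ring
  rw [hsub, AddValuation.map_mul V'.toAddValuation φ' q]
  have hV : V (a * b) ≤ V φ' + V q := by
    rw [← AddValuation.map_mul, ← hsub]
    exact AddValuation.map_le_sub _ le_rfl hr2
  have hφ' : V' φ' = μ' := by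
    rw [h'.eq, expansionMin_self (AddValuation.map_zero _) (AddValuation.map_one _) hm hd]
  have hdq : q.degree < φ'.degree := by
    by_cases hq0 : q = 0
    · rw [hq0, degree_zero, bot_lt_iff_ne_bot]
      exact degree_ne_bot.2 hm.ne_zero
    apply degree_lt_degree
    have h1 := natDegree_divByMonic (a * b) hm
    rw [← hq, natDegree_mul ha hb] at h1
    have := natDegree_lt_natDegree ha hda
    have := natDegree_lt_natDegree hb hdb
    omega
  rw [hab, hlow q hdq]
  by_cases hq0 : q = 0
  · rw [hq0, AddValuation.map_zero, WithTop.add_top]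
    exact lt_top_iff_ne_top.2 hfin
  · have hq1 := h.ne_top_of_ne_zero hμ hq0
    exact hV.trans_lt (WithTop.add_lt_add_right hq1 (hφ' ▸ h'.lt))

end IsStage

end Stage

/-! ### One-slope Newton polygons -/

section Newton

theorem lt_add_nsmul {u t μ x : WithTop ℝ} {m : ℕ} (hm : m ≠ 0) (h : u ≤ t + m • μ) (hx : μ < x)
    (hu : u ≠ ⊤) : u < t + m • x := by
  induction t with
  | top => simpa [lt_top_iff_ne_top] using hu
  | coe t =>
  induction x with
  | top =>
    rw [← Nat.succ_pred_eq_of_pos (Nat.pos_of_ne_zero hm), succ_nsmul]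
    simpa [lt_top_iff_ne_top] using hu
  | coe x =>
  lift μ to ℝ using hx.ne_top
  lift u to ℝ using hu
  rw [← WithTop.coe_nsmul, ← WithTop.coe_add, WithTop.coe_le_coe] at h
  rw [← WithTop.coe_nsmul, ← WithTop.coe_add, WithTop.coe_lt_coe]
  rw [WithTop.coe_lt_coe] at hx
  have : m • μ < m • x := nsmul_lt_nsmul_right hm hx
  linarith

theorem IsNewtonKeyValue.congr {K : Type*} [NormedField K] {w w' : K[X] → WithTop ℝ} {φ f : K[X]}
    {μ : WithTop ℝ} (h : IsNewtonKeyValue w φ f μ) (hφ : φ.Monic)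
    (hw : ∀ c : K[X], c.degree < φ.degree → w c = w' c) : IsNewtonKeyValue w' φ f μ := by
  obtain ⟨h1, h2, h3⟩ := h
  have hw' (m : ℕ) : w (digit φ f m) = w' (digit φ f m) := hw _ (degree_digit_lt hφ f m)
  simp only [hw'] at h2 h3
  exact ⟨h1, h2, h3⟩

theorem digit_natDegree_div_ne_zero {K : Type*} [NormedField K] {φ f : K[X]} (hφ : φ.Monic) (hd : 0 < φ.natDegree)
    (hf : f ≠ 0) : digit φ f (f.natDegree / φ.natDegree) ≠ 0 := by
  set N := f.natDegree / φ.natDegree with hN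
  have h0 : f /ₘ φ ^ N ≠ 0 := by
    rw [Ne, divByMonic_eq_zero_iff (hφ.pow N), not_lt, degree_eq_natDegree hf,
      degree_eq_natDegree (hφ.pow N).ne_zero, hφ.natDegree_pow]
    exact_mod_cast Nat.div_mul_le_self _ _
  rwa [digit, (modByMonic_eq_self_iff hφ).2]
  apply degree_lt_degree
  rw [natDegree_divByMonic _ (hφ.pow N), hφ.natDegree_pow]
  have := Nat.div_add_mod' f.natDegree φ.natDegree
  have := Nat.mod_lt f.natDegree hd
  rw [← hN] at *
  omega

variable {K : Type*} [NormedField K] [IsUltrametricDist K]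

/-- The value of `φ` at a zero of `f` is the negative of the unique slope of the Newton polygon. -/
theorem IsNewtonKeyValue.map_eq {U : KSemivaluation K K[X]} {φ f : K[X]} {μ : WithTop ℝ}
    (h : IsNewtonKeyValue U φ f μ) (hφ : φ.Monic) (hd : 0 < φ.natDegree) (hf : f ≠ 0)
    (hU : U f = ⊤) (hμ : μ ≠ ⊤) (hfin : ∀ c : K[X], c ≠ 0 → c.degree < φ.degree → U c ≠ ⊤) :
    U φ = μ := by
  obtain ⟨hN, h0, hle⟩ := h
  have hcN := hfin _ (digit_natDegree_div_ne_zero hφ hd hf) (degree_digit_lt hφ f _)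
  have hNd : f.natDegree < (f.natDegree / φ.natDegree + 1) * φ.natDegree := by
    have := Nat.div_add_mod' f.natDegree φ.natDegree
    have := Nat.mod_lt f.natDegree hd
    rw [add_mul, one_mul]
    omega
  set N := f.natDegree / φ.natDegree
  have hsum := sum_digit hφ hNd
  have hc0 : U (digit φ f 0) ≠ ⊤ := by
    rw [h0]
    lift μ to ℝ using hμ
    rw [← WithTop.coe_nsmul, Ne, WithTop.add_eq_top, not_or]
    exact ⟨hcN, WithTop.coe_ne_top⟩
  rcases lt_trichotomy (U φ) μ with hlt | heq | hgt
  · exfalso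
    rw [Finset.sum_range_succ] at hsum
    have hx := hlt.ne_top
    have htop : U (digit φ f N * φ ^ N) ≠ ⊤ := by
      rw [AddValuation.map_mul, AddValuation.map_pow]
      lift U φ to ℝ using hx with x
      rw [← WithTop.coe_nsmul, Ne, WithTop.add_eq_top, not_or]
      exact ⟨hcN, WithTop.coe_ne_top⟩
    -- If `U φ < μ`, the leading term alone has the least value, so `U f` would be finite.
    have hlt' : U (digit φ f N * φ ^ N) < U (∑ m ∈ Finset.range N, digit φ f m * φ ^ m) := by
      refine AddValuation.map_lt_sum _ htop fun m hm => ?_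
      rw [Finset.mem_range] at hm
      have h1 := hle m hm.le
      rw [h0] at h1
      rw [AddValuation.map_mul, AddValuation.map_pow, AddValuation.map_mul, AddValuation.map_pow]
      revert h1 hcN
      generalize U (digit φ f N) = u
      generalize U (digit φ f m) = t
      intro hcN h1
      lift U φ to ℝ using hx with x
      lift μ to ℝ using hμ
      lift u to ℝ using hcN
      induction t with
      | top =>
        rw [← WithTop.coe_nsmul, ← WithTop.coe_add, WithTop.top_add]
        exact WithTop.coe_lt_top _
      | coe t =>
      simp only [← WithTop.coe_nsmul, ← WithTop.coe_add, WithTop.coe_le_coe, WithTop.coe_lt_coe,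
        nsmul_eq_mul] at h1 hlt ⊢
      have : (m : ℝ) < N := by exact_mod_cast hm
      nlinarith
    rw [← hsum, AddValuation.map_add_eq_of_lt_right _ hlt'] at hU
    exact htop hU
  · exact heq
  · exfalso
    rw [Finset.sum_range_succ'] at hsum
    simp only [pow_zero, mul_one] at hsum
    -- If `U φ > μ`, the constant term alone has the least value.
    have hlt : U (digit φ f 0) <
        U (∑ m ∈ Finset.range N, digit φ f (m + 1) * φ ^ (m + 1)) := by
      refine AddValuation.map_lt_sum _ hc0 fun m hm => ?_
      rw [AddValuation.map_mul, AddValuation.map_pow]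
      exact lt_add_nsmul m.succ_ne_zero (hle (m + 1) (Finset.mem_range.1 hm)) hgt hc0
    rw [← hsum, AddValuation.map_add_eq_of_lt_right _ hlt] at hU
    exact hc0 hU

end Newton

/-! ### Comparison of the approximants with `V n` -/

section Approximants

variable {K : Type*} [NontriviallyNormedField K] [IsUltrametricDist K] [CompleteSpace K]

namespace IsApproximants

variable {f : K[X]} {n : ℕ} {V : ℕ → KSemivaluation K K[X]} {φ : ℕ → K[X]} {μ : ℕ → WithTop ℝ}

theorem isStage (h : IsApproximants f n V φ μ) {i : ℕ} (hi : 1 ≤ i) (hin : i ≤ n) :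
    IsStage (V i) (φ i) (μ i) := by
  induction i, hi using Nat.le_induction with
  | base =>
    obtain ⟨a, ha, h1⟩ := h.first
    rw [ha]
    exact h1.isStage
  | succ i hi ih =>
    exact ((ih (by omega)).isAugmentation (h.ne_top i hi (by omega))
      (h.isAugmentation i hi (by omega))).1

theorem map_succ (h : IsApproximants f n V φ μ) {i : ℕ} (hi : 1 ≤ i) (hin : i < n) {c : K[X]}
    (hc : c.degree < (φ (i + 1)).degree) : V (i + 1) c = V i c :=
  ((h.isStage hi hin.le).isAugmentation (h.ne_top i hi hin)
    (h.isAugmentation i hi hin)).2 c hc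

theorem degree_mono (h : IsApproximants f n V φ μ) {i l : ℕ} (hi : 1 ≤ i) (hil : i ≤ l)
    (hl : l ≤ n) : (φ i).degree ≤ (φ l).degree := by
  induction l, hil using Nat.le_induction with
  | base => exact le_rfl
  | succ l hil ih =>
    exact (ih (by omega)).trans ((h.isStage (by omega) (by omega)).degree_le_of_isKeyPolynomial
      (h.isAugmentation l (by omega) (by omega)).isKeyPolynomial)

/-- An augmentation does not change values below the degree of its key polynomial, and these degrees
do not decrease. -/
theorem map_last (h : IsApproximants f n V φ μ) {i : ℕ} (hi : 1 ≤ i) (hin : i ≤ n) {c : K[X]}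
    (hc : c.degree < (φ i).degree) : V n c = V i c := by
  have key : ∀ l, i ≤ l → l ≤ n → V l c = V i c := by
    intro l hil
    induction l, hil using Nat.le_induction with
    | base => exact fun _ => rfl
    | succ l hil ih =>
      intro hl
      rw [h.map_succ (by omega) (by omega) (hc.trans_le (h.degree_mono hi (by omega) hl)),
        ih (by omega)]
  exact key n hin le_rfl

theorem map_last_of_degree_lt_succ (h : IsApproximants f n V φ μ) {i : ℕ} (hi : 1 ≤ i)
    (hin : i < n) {c : K[X]} (hc : c.degree < (φ (i + 1)).degree) : V n c = V i c := by
  rw [h.map_last (by omega) hin hc, h.map_succ hi hin hc]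

theorem map_last_self (h : IsApproximants f n V φ μ) : V n f = ⊤ := by
  obtain ⟨α, hα, h1⟩ := h.last
  rw [h1, hα, AddValuation.map_zero]

/-- The remainder of `f` modulo `φ n` has value at least `V n f = ∞`, but nonzero polynomials of
such small degree have finite value. -/
theorem key_last_dvd (h : IsApproximants f n V φ μ) : φ n ∣ f := by
  have hs := h.isStage h.one_le le_rfl
  rw [← modByMonic_eq_zero_iff_dvd hs.monic]
  by_contra h0
  apply hs.ne_top _ h0 (degree_modByMonic_lt _ hs.monic)
  rw [← top_le_iff, ← h.map_last_self]
  exact hs.le_modByMonic f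

/-- Digits have degree below `deg (φ i)`, where the preceding stage agrees with `V n`. So the Newton
polygon may be computed with the valuation at the root of `f`. -/
theorem isNewtonKeyValue (h : IsApproximants f n V φ μ) {i : ℕ} (hi : 1 ≤ i) (hin : i ≤ n) :
    IsNewtonKeyValue (V n) (φ i) f (μ i) := by
  obtain rfl | ⟨l, hl, rfl⟩ : i = 1 ∨ ∃ l, 1 ≤ l ∧ i = l + 1 := by
    rcases hi.eq_or_lt with rfl | hi
    · exact Or.inl rfl
    · exact Or.inr ⟨i - 1, by omega, by omega⟩
  · refine h.first_keyValue.congr (h.isStage hi hin).monic fun c hc => ?_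
    obtain ⟨a, ha, -⟩ := h.first
    rw [ha] at hc
    exact ((V n).apply_of_degree_lt_X_sub_C hc).symm
  · exact (h.keyValue l hl hin).congr (h.isStage hi hin).monic
      fun c hc => (h.map_last_of_degree_lt_succ hl hin hc).symm

theorem map_last_key (h : IsApproximants f n V φ μ) (hf : f ≠ 0) {i : ℕ} (hi : 1 ≤ i)
    (hin : i ≤ n) : V n (φ i) = μ i := by
  rcases hin.eq_or_lt with rfl | hin'
  · exact (h.isStage hi le_rfl).map_key
  have hs := h.isStage hi hin
  refine (h.isNewtonKeyValue hi hin).map_eq hs.monic hs.natDegree_pos hf h.map_last_self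
    (h.ne_top i hi hin') fun c hc hcd => ?_
  rw [h.map_last hi hin hcd]
  exact hs.ne_top c hc hcd

end IsApproximants

end Approximants

/-! ### From additive values to norms -/

section ExpNeg

/-- The function `r ↦ exp (-r)` from `ℝ ∪ {∞}` to the nonnegative reals. -/
def expNeg : WithTop ℝ → ℝ :=
  WithTop.recTopCoe 0 fun r => Real.exp (-r)

@[simp] theorem expNeg_top : expNeg ⊤ = 0 := rfl

@[simp] theorem expNeg_coe (r : ℝ) : expNeg r = Real.exp (-r) := rfl

theorem expNeg_add (x y : WithTop ℝ) : expNeg (x + y) = expNeg x * expNeg y := by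
  induction x with
  | top => simp
  | coe x =>
  induction y with
  | top => simp
  | coe y => rw [← WithTop.coe_add, expNeg_coe, expNeg_coe, expNeg_coe, ← Real.exp_add]; ring_nf

theorem expNeg_strictAnti : StrictAnti expNeg := by
  intro x y hxy
  lift x to ℝ using hxy.ne_top
  induction y with
  | top => exact Real.exp_pos _
  | coe y => exact Real.exp_lt_exp.2 (neg_lt_neg (WithTop.coe_lt_coe.1 hxy))

theorem expNeg_zero : expNeg 0 = 1 := by
  rw [← WithTop.coe_zero, expNeg_coe]
  simp

theorem expNeg_ordNorm {L : Type*} [NormedField L] [IsUltrametricDist L] (x : L) :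
    expNeg (ordNorm L x) = ‖x‖ := by
  by_cases hx : x = 0
  · simp [hx, AddValuation.map_zero]
  · rw [ordNorm_of_ne_zero hx, expNeg_coe, neg_neg, Real.exp_log (norm_pos_iff.2 hx)]

theorem ordNorm_lt_iff {L : Type*} [NormedField L] [IsUltrametricDist L] {x y : L} :
    ordNorm L x < ordNorm L y ↔ ‖y‖ < ‖x‖ := by
  rw [← expNeg_ordNorm, ← expNeg_ordNorm, expNeg_strictAnti.lt_iff_gt]

theorem ordNorm_le_iff {L : Type*} [NormedField L] [IsUltrametricDist L] {x y : L} :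
    ordNorm L x ≤ ordNorm L y ↔ ‖y‖ ≤ ‖x‖ := by
  rw [← expNeg_ordNorm, ← expNeg_ordNorm, expNeg_strictAnti.le_iff_ge]

end ExpNeg

/-! ### Uniqueness of the extended valuation -/

section Unique

variable {K : Type*} [NontriviallyNormedField K] [IsUltrametricDist K] [CompleteSpace K]

theorem expNeg_extendedValuation {L : Type*} [Field L] [Algebra K L] [Algebra.IsAlgebraic K L]
    (x : L) : expNeg (extendedValuation K L x) = spectralNorm K L x :=
  letI : NormedField L := spectralNorm.normedField K L
  haveI : IsUltrametricDist L :=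
    IsUltrametricDist.isUltrametricDist_of_forall_norm_add_le_max_norm
      (isNonarchimedean_spectralNorm (K := K) (L := L))
  expNeg_ordNorm x

/-- A complete valuation has only one extension to an algebraic extension. -/
theorem KSemivaluation.eq_extendedValuation {L : Type*} [Field L] [Algebra K L]
    [Algebra.IsAlgebraic K L] (W : KSemivaluation K L) (x : L) :
    W x = extendedValuation K L x := by
  let F : AbsoluteValue L ℝ :=
    { toFun := fun x => expNeg (W x)
      map_mul' := fun x y => by rw [AddValuation.map_mul, expNeg_add]
      nonneg' := fun x => by
        rw [← expNeg_top]
        exact expNeg_strictAnti.antitone le_top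
      eq_zero' := fun x => by
        rw [← expNeg_top, expNeg_strictAnti.injective.eq_iff, AddValuation.top_iff]
      add_le' := fun x y => by
        have h0 (z : L) : 0 ≤ expNeg (W z) := by
          rw [← expNeg_top]
          exact expNeg_strictAnti.antitone le_top
        rcases AddValuation.map_add' W.toAddValuation x y with h | h
        · exact (expNeg_strictAnti.antitone h).trans (le_add_of_nonneg_right (h0 y))
        · exact (expNeg_strictAnti.antitone h).trans (le_add_of_nonneg_left (h0 x)) }
  apply expNeg_strictAnti.injective
  rw [expNeg_extendedValuation]
  exact spectralNorm_unique_field_norm_ext (f := F) (fun a => by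
    change expNeg (W (algebraMap K L a)) = _
    rw [W.map_algebraMap, expNeg_ordNorm]) x

theorem extendedValuation_algHom {L L' : Type*} [Field L] [Algebra K L] [Algebra.IsAlgebraic K L]
    [Field L'] [Algebra K L'] [Algebra.IsAlgebraic K L'] (i : L →ₐ[K] L') (x : L) :
    extendedValuation K L' (i x) = extendedValuation K L x := by
  apply expNeg_strictAnti.injective
  rw [expNeg_extendedValuation, expNeg_extendedValuation, spectralNorm, spectralNorm,
    minpoly.algHom_eq i i.injective]

theorem norm_algEquiv (σ : AlgebraicClosure K ≃ₐ[K] AlgebraicClosure K) (x : AlgebraicClosure K) :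
    ‖σ x‖ = ‖x‖ :=
  (spectralNorm_eq_of_equiv σ x).symm

end Unique

/-! ### The valuation of `K[X]/(φ)` -/

section AdjoinRoot

variable {K : Type*} [NormedField K] [IsUltrametricDist K]

/-- The remainder of degree `< deg φ` that represents an element of `K[X] / (φ)`. -/
abbrev IsStage.rep {V : KSemivaluation K K[X]} {φ : K[X]} {μ : WithTop ℝ} (h : IsStage V φ μ) :
    AdjoinRoot φ →ₗ[K] K[X] :=
  AdjoinRoot.modByMonicHom h.monic

namespace IsStage

variable {V : KSemivaluation K K[X]} {φ : K[X]} {μ : WithTop ℝ}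

theorem rep_mk (h : IsStage V φ μ) (a : K[X]) : h.rep (AdjoinRoot.mk φ a) = a %ₘ φ :=
  AdjoinRoot.modByMonicHom_mk h.monic a

theorem mk_rep (h : IsStage V φ μ) (x : AdjoinRoot φ) : AdjoinRoot.mk φ (h.rep x) = x :=
  AdjoinRoot.mk_leftInverse h.monic x

theorem degree_rep_lt (h : IsStage V φ μ) (x : AdjoinRoot φ) : (h.rep x).degree < φ.degree := by
  obtain ⟨a, rfl⟩ := AdjoinRoot.mk_surjective x
  rw [h.rep_mk]
  exact degree_modByMonic_lt _ h.monic

theorem rep_mul (h : IsStage V φ μ) (x y : AdjoinRoot φ) :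
    h.rep (x * y) = (h.rep x * h.rep y) %ₘ φ := by
  conv_lhs => rw [← h.mk_rep x, ← h.mk_rep y, ← map_mul, h.rep_mk]

theorem rep_algebraMap (h : IsStage V φ μ) (a : K) :
    h.rep (algebraMap K (AdjoinRoot φ) a) = C a := by
  rw [AdjoinRoot.algebraMap_eq, ← AdjoinRoot.mk_C, h.rep_mk, (modByMonic_eq_self_iff h.monic).2]
  exact degree_C_le.trans_lt (natDegree_pos_iff_degree_pos.1 h.natDegree_pos)

/-- The valuation that a stage induces on `K[X] / (φ)`. -/
def adjoinRootValuation (h : IsStage V φ μ) : KSemivaluation K (AdjoinRoot φ) where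
  toAddValuation := AddValuation.of (fun x => V (h.rep x)) (by simp [AddValuation.map_zero])
    (by
      have := h.rep_algebraMap 1
      rw [map_one, C_1] at this
      rw [this, AddValuation.map_one])
    (fun x y => by
      rw [map_add]
      exact AddValuation.map_add _ _ _)
    (fun x y => by
      rw [h.rep_mul, h.map_mul_modByMonic (h.degree_rep_lt x) (h.degree_rep_lt y)])
  map_algebraMap a := by
    change V (h.rep _) = _
    rw [h.rep_algebraMap, V.map_C]

end IsStage

end AdjoinRoot

section AdjoinRoot

variable {K : Type*} [NontriviallyNormedField K] [IsUltrametricDist K] [CompleteSpace K]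

namespace IsStage

variable {V : KSemivaluation K K[X]} {φ : K[X]} {μ : WithTop ℝ}

theorem extendedValuation_eq (h : IsStage V φ μ) [Fact (Irreducible φ)]
    [Algebra.IsAlgebraic K (AdjoinRoot φ)] (x : AdjoinRoot φ) :
    extendedValuation K (AdjoinRoot φ) x = V (h.rep x) :=
  (h.adjoinRootValuation.eq_extendedValuation x).symm

/-- The valuation of `K[X]/(φ)` given by remainders is the unique extension of `v`, and it is
preserved by the embedding into the algebraic closure that sends the class of `X` to `β`. -/
theorem ordNorm_aeval (h : IsStage V φ μ) {β : AlgebraicClosure K} (hβ : aeval β φ = 0) {a : K[X]}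
    (ha : a.degree < φ.degree) : ordNorm (AlgebraicClosure K) (aeval β a) = V a := by
  have : Fact (Irreducible φ) := ⟨h.irreducible⟩
  have _ := (AdjoinRoot.powerBasis h.irreducible.ne_zero).finite
  have : Algebra.IsAlgebraic K (AdjoinRoot φ) := Algebra.IsAlgebraic.of_finite K (AdjoinRoot φ)
  have hβ' : eval₂ (Algebra.ofId K (AlgebraicClosure K) : K →+* AlgebraicClosure K) β φ = 0 := hβ
  have h1 := extendedValuation_algHom (AdjoinRoot.liftAlgHom φ (Algebra.ofId K _) β hβ')
    (AdjoinRoot.mk φ a)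
  rw [h.extendedValuation_eq, h.rep_mk, (modByMonic_eq_self_iff h.monic).2 ha,
    AdjoinRoot.liftAlgHom_mk] at h1
  exact h1

end IsStage

end AdjoinRoot

/-! ### Reduction to residue fields -/

section ResidueMap

variable {K : Type*} [NormedField K] [IsUltrametricDist K]

theorem isUnit_integers_iff {F : Type*} [Field F] (w : AddValuation F (WithTop ℝ))
    (x : integers w) : IsUnit x ↔ ¬ 0 < w (x : F) := by
  constructor
  · rintro hx h0
    obtain ⟨y, hy⟩ := hx.exists_right_inv
    have h1 : w (x : F) + w (y : F) = 0 := by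
      rw [← AddValuation.map_mul, ← AddValuation.map_one w]
      exact congrArg w (congrArg Subtype.val hy)
    exact (add_pos_of_pos_of_nonneg h0 ((mem_integers w _).1 y.2)).ne' h1
  · intro h
    have h1 : w (x : F) = 0 := le_antisymm (not_lt.1 h) ((mem_integers w _).1 x.2)
    have h0 : (x : F) ≠ 0 := by
      intro h0
      rw [h0, AddValuation.map_zero] at h1
      exact WithTop.top_ne_zero h1
    refine IsUnit.of_mul_eq_one (⟨(x : F)⁻¹, ?_⟩ : integers w) (Subtype.ext (mul_inv_cancel₀ h0))
    rw [mem_integers, AddValuation.map_inv, h1]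
    simp

/-- The reduction map of the valuation ring of an extension of `K`. -/
def residueMap {F : Type*} [Field F] [Algebra K F] (W : KSemivaluation K F) :
    integers W.toAddValuation →+* ResidueField W :=
  IsLocalRing.residue _

theorem residueMap_surjective {F : Type*} [Field F] [Algebra K F] (W : KSemivaluation K F) :
    Function.Surjective (residueMap W) :=
  IsLocalRing.residue_surjective

theorem residueMap_eq_zero_iff {F : Type*} [Field F] [Algebra K F] (W : KSemivaluation K F)
    (x : integers W.toAddValuation) : residueMap W x = 0 ↔ 0 < W (x : F) := by
  have h : residueMap W x = 0 ↔ x ∈ IsLocalRing.maximalIdeal (integers W.toAddValuation) :=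
    IsLocalRing.residue_eq_zero_iff x
  rw [h, IsLocalRing.mem_maximalIdeal, mem_nonunits_iff, isUnit_integers_iff, not_not]

theorem algebraMap_residue {F : Type*} [Field F] [Algebra K F] (W : KSemivaluation K F)
    (a : integers (ordNorm K)) :
    algebraMap (BaseResidueField K) (ResidueField W) (IsLocalRing.residue _ a) =
      residueMap W (integersMap W a) :=
  rfl

theorem toFrac_mem_integers {R : Type*} [CommRing R] [Algebra K R] (V : KSemivaluation K R) {g : R}
    (hg : 0 ≤ V g) : toFrac V g ∈ integers (frac V).toAddValuation := by
  rw [mem_integers]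
  exact (fracAddValuation_toFrac V g).symm ▸ hg

theorem frac_toFrac {R : Type*} [CommRing R] [Algebra K R] (V : KSemivaluation K R) (g : R) :
    (frac V) (toFrac V g) = V g :=
  fracAddValuation_toFrac V g

theorem reduction_eq {R : Type*} [CommRing R] [Algebra K R] (V : KSemivaluation K R)
    (g : integerRing V) :
    reduction V g = residueMap (frac V) ⟨toFrac V g, toFrac_mem_integers V g.2⟩ :=
  rfl

theorem reduction_eq_zero_iff {R : Type*} [CommRing R] [Algebra K R] (V : KSemivaluation K R)
    (g : integerRing V) : reduction V g = 0 ↔ 0 < V (g : R) := by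
  rw [reduction_eq, residueMap_eq_zero_iff, frac_toFrac]

theorem algebraMap_eq_reduction {R : Type*} [CommRing R] [Algebra K R] (V : KSemivaluation K R)
    (a : integers (ordNorm K)) (h : algebraMap K R a ∈ integerRing V) :
    algebraMap (BaseResidueField K) (Lam V) (IsLocalRing.residue _ a) =
      reduction V ⟨algebraMap K R a, h⟩ :=
  rfl

theorem IsStage.pos_sub_modByMonic {V : KSemivaluation K K[X]} {φ : K[X]} {μ : WithTop ℝ}
    (h : IsStage V φ μ) {a b : K[X]} (hda : a.degree < φ.degree)
    (hdb : b.degree < φ.degree) (ha : 0 ≤ V a) (hb : 0 ≤ V b) :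
    0 < V (a * b - (a * b) %ₘ φ) := by
  by_cases ha0 : a = 0
  · simp [ha0, AddValuation.map_zero]
  by_cases hb0 : b = 0
  · simp [hb0, AddValuation.map_zero]
  refine lt_of_le_of_lt ?_ (h.lt_sub_modByMonic a b ha0 hb0 hda hdb)
  rw [AddValuation.map_mul]
  exact add_nonneg ha hb

end ResidueMap

/-! ### The residue field of `K[X]/(φ)` inside `Λ(V)` -/

section Complete

variable {K : Type*} [NontriviallyNormedField K] [IsUltrametricDist K] [CompleteSpace K]

/-- Spectral norm at most `1` means that the minimal polynomial has integral coefficients. Its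
reduction is a monic relation for the residue class. -/
theorem isAlgebraic_residueField (L : Type*) [Field L] [Algebra K L] [Algebra.IsAlgebraic K L] :
    Algebra.IsAlgebraic (BaseResidueField K) (ResidueField (extendedValuation K L)) := by
  let W := extendedValuation K L
  refine ⟨fun (x : ResidueField W) => ?_⟩
  obtain ⟨y, hyx⟩ := residueMap_surjective W x
  have hint : IsIntegral K (y : L) := (Algebra.IsAlgebraic.isAlgebraic (y : L)).isIntegral
  have hm := minpoly.monic hint
  have hy : spectralNorm K L (y : L) ≤ 1 := by
    rw [← expNeg_extendedValuation, ← expNeg_zero]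
    exact expNeg_strictAnti.antitone ((mem_integers _ _).1 y.2)
  have hcoeff (n : ℕ) : (minpoly K (y : L)).coeff n ∈ integers (ordNorm K) := by
    rw [mem_integers, ← AddValuation.map_one (ordNorm K), ordNorm_le_iff, norm_one]
    exact (spectralValue_le_one_iff hm).1 hy n
  obtain ⟨P, hP, -, hPm⟩ := lifts_and_natDegree_eq_and_monic
    (f := (integers (ordNorm K)).subtype) (p := minpoly K (y : L))
    ((lifts_iff_coeff_lifts _).2 fun n => ⟨⟨_, hcoeff n⟩, rfl⟩) hm
  refine ⟨P.map (IsLocalRing.residue _), (hPm.map _).ne_zero, ?_⟩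
  have h0 : eval₂ (integersMap W) y P = 0 := by
    apply Subtype.ext
    have h1 : eval₂ ((algebraMap K L).comp (integers (ordNorm K)).subtype) (y : L) P = 0 := by
      rw [← eval₂_map, hP]
      exact minpoly.aeval K (y : L)
    rw [ZeroMemClass.coe_zero, ← h1]
    exact hom_eval₂ P (integersMap W) (integers W.toAddValuation).subtype y
  rw [aeval_def, eval₂_map]
  have h2 := hom_eval₂ P (integersMap W) (residueMap W) y
  rw [h0, map_zero, hyx] at h2
  exact h2.symm

namespace IsStage

variable {V : KSemivaluation K K[X]} {φ : K[X]} {μ : WithTop ℝ}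

/-- The map from the residue field of `K[X] / (φ)` to the residue class field of a semivaluation `U`
that agrees with `V` on the polynomials of degree `< deg φ`. -/
def residueHom (h : IsStage V φ μ) [Fact (Irreducible φ)] [Algebra.IsAlgebraic K (AdjoinRoot φ)]
    (U : KSemivaluation K K[X]) (hU : ∀ a : K[X], a.degree < φ.degree → U a = V a)
    (hU' : ∀ a b : K[X], a.degree < φ.degree → b.degree < φ.degree → 0 ≤ U a → 0 ≤ U b →
      0 < U (a * b - (a * b) %ₘ φ)) :
    ResidueField (extendedValuation K (AdjoinRoot φ)) →+* Lam U :=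
  have hval (x : AdjoinRoot φ) : U (h.rep x) = extendedValuation K (AdjoinRoot φ) x := by
    rw [hU _ (h.degree_rep_lt x), h.extendedValuation_eq]
  have hmem (x : integers (extendedValuation K (AdjoinRoot φ)).toAddValuation) :
      h.rep x ∈ integerRing U := by
    rw [mem_integerRing, hval]
    exact x.2
  let F : integers (extendedValuation K (AdjoinRoot φ)).toAddValuation →+* Lam U :=
    { toFun := fun x => reduction U ⟨h.rep x, hmem x⟩
      map_zero' := by
        rw [reduction_eq_zero_iff]
        simp [AddValuation.map_zero]
      map_one' := by
        rw [← map_one (reduction U)]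
        congr 1
        have := h.rep_algebraMap 1
        rw [map_one, C_1] at this
        exact Subtype.ext this
      map_add' := fun x y => by
        rw [← map_add]
        congr 1
        exact Subtype.ext (map_add h.rep _ _)
      map_mul' := fun x y => by
        -- A product and its remainder have the same reduction: this is the hypothesis `hU'`.
        rw [← map_mul, eq_comm, ← sub_eq_zero, ← map_sub, reduction_eq_zero_iff]
        have := hU' _ _ (h.degree_rep_lt x) (h.degree_rep_lt y) (hmem x) (hmem y)
        rw [← h.rep_mul] at this
        exact this }
  haveI : IsLocalHom F := ⟨fun x hx => by
    rw [isUnit_integers_iff]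
    have h1 : ¬ reduction U ⟨h.rep x, hmem x⟩ = 0 := hx.ne_zero
    rw [reduction_eq_zero_iff] at h1
    rwa [← hval]⟩
  IsLocalRing.ResidueField.lift F

variable [Fact (Irreducible φ)] [Algebra.IsAlgebraic K (AdjoinRoot φ)]

theorem rep_mem_integerRing (h : IsStage V φ μ) {U : KSemivaluation K K[X]}
    (hU : ∀ a : K[X], a.degree < φ.degree → U a = V a)
    (x : integers (extendedValuation K (AdjoinRoot φ)).toAddValuation) :
    h.rep x ∈ integerRing U := by
  rw [mem_integerRing, hU _ (h.degree_rep_lt x), ← h.extendedValuation_eq]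
  exact x.2

theorem residueHom_residueMap (h : IsStage V φ μ) (U : KSemivaluation K K[X])
    (hU : ∀ a : K[X], a.degree < φ.degree → U a = V a)
    (hU' : ∀ a b : K[X], a.degree < φ.degree → b.degree < φ.degree → 0 ≤ U a → 0 ≤ U b →
      0 < U (a * b - (a * b) %ₘ φ))
    (x : integers (extendedValuation K (AdjoinRoot φ)).toAddValuation) :
    h.residueHom U hU hU' (residueMap _ x) =
      reduction U ⟨h.rep x, h.rep_mem_integerRing hU x⟩ :=
  rfl

theorem residueHom_algebraMap (h : IsStage V φ μ) (U : KSemivaluation K K[X])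
    (hU : ∀ a : K[X], a.degree < φ.degree → U a = V a)
    (hU' : ∀ a b : K[X], a.degree < φ.degree → b.degree < φ.degree → 0 ≤ U a → 0 ≤ U b →
      0 < U (a * b - (a * b) %ₘ φ)) (c : BaseResidueField K) :
    h.residueHom U hU hU' (algebraMap _ _ c) = algebraMap _ (Lam U) c := by
  obtain ⟨a, rfl⟩ := IsLocalRing.residue_surjective c
  have ha : algebraMap K K[X] a ∈ integerRing U := by
    rw [mem_integerRing, U.map_algebraMap]
    exact a.2
  rw [algebraMap_residue, residueHom_residueMap, algebraMap_eq_reduction U a ha]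
  congr 1
  exact Subtype.ext (h.rep_algebraMap a)

/-- The embedding of the residue field of `K[X] / (φ)` into the residue class field of a stage. -/
def lamHom (h : IsStage V φ μ) :
    ResidueField (extendedValuation K (AdjoinRoot φ)) →ₐ[BaseResidueField K] Lam V where
  toRingHom := h.residueHom V (fun _ _ => rfl) fun _ _ => h.pos_sub_modByMonic
  commutes' := h.residueHom_algebraMap V (fun _ _ => rfl) fun _ _ => h.pos_sub_modByMonic

theorem reduction_mem_range_lamHom (h : IsStage V φ μ) {a : K[X]} (hd : a.degree < φ.degree)
    (ha : a ∈ integerRing V) : reduction V ⟨a, ha⟩ ∈ h.lamHom.range := by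
  have hrep : h.rep (AdjoinRoot.mk φ a) = a := by
    rw [h.rep_mk, (modByMonic_eq_self_iff h.monic).2 hd]
  have hmem : AdjoinRoot.mk φ a ∈ integers (extendedValuation K (AdjoinRoot φ)).toAddValuation := by
    rw [mem_integers, h.extendedValuation_eq, hrep]
    exact ha
  refine ⟨residueMap _ ⟨AdjoinRoot.mk φ a, hmem⟩, ?_⟩
  refine (h.residueHom_residueMap V (fun _ _ => rfl) (fun _ _ => h.pos_sub_modByMonic) _).trans ?_
  congr 1
  exact Subtype.ext hrep

end IsStage

end Complete

/-! ### Elements of `Λ(V)` as classes of fractions -/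

section Ratio

variable {K : Type*} [NormedField K] [IsUltrametricDist K]

/-- The element `x` of the residue class field of `V` is the residue class of `P / Q`. -/
def IsRatio (V : KSemivaluation K K[X]) (x : Lam V) (P Q : K[X]) : Prop :=
  V Q ≠ ⊤ ∧ ∃ ξ : integers (frac V).toAddValuation, residueMap (frac V) ξ = x ∧
    (ξ : FracField V) * toFrac V Q = toFrac V P

variable {V : KSemivaluation K K[X]}

theorem toFrac_ne_zero {Q : K[X]} (hQ : V Q ≠ ⊤) : toFrac V Q ≠ 0 := by
  intro h
  rw [← frac_toFrac, h, AddValuation.map_zero] at hQ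
  exact hQ rfl

theorem exists_isRatio (x : Lam V) : ∃ P Q : K[X], IsRatio V x P Q := by
  obtain ⟨ξ, rfl⟩ := residueMap_surjective (frac V) x
  obtain ⟨a, b, hb, hab⟩ := IsFractionRing.div_surjective (K[X] ⧸ supp V) (ξ : FracField V)
  obtain ⟨P, rfl⟩ := Ideal.Quotient.mk_surjective a
  obtain ⟨Q, rfl⟩ := Ideal.Quotient.mk_surjective b
  have hQ : V Q ≠ ⊤ := by
    intro h
    apply nonZeroDivisors.ne_zero hb
    rw [Ideal.Quotient.eq_zero_iff_mem]
    exact h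
  refine ⟨P, Q, hQ, ξ, rfl, ?_⟩
  rw [← hab]
  exact div_mul_cancel₀ _ (toFrac_ne_zero hQ)

namespace IsRatio

variable {x : Lam V} {P Q P' Q' : K[X]}

theorem exists_add_eq (h : IsRatio V x P Q) :
    ∃ u : WithTop ℝ, 0 ≤ u ∧ (x = 0 ↔ 0 < u) ∧ u + V Q = V P := by
  obtain ⟨-, ξ, rfl, h1⟩ := h
  refine ⟨frac V (ξ : FracField V), (mem_integers _ _).1 ξ.2, residueMap_eq_zero_iff _ _, ?_⟩
  rw [← frac_toFrac V P, ← h1, AddValuation.map_mul, frac_toFrac]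

theorem le (h : IsRatio V x P Q) : V Q ≤ V P := by
  obtain ⟨u, hu, -, h1⟩ := h.exists_add_eq
  rw [← h1]
  exact le_add_of_nonneg_left hu

theorem eq_of_ne_zero (h : IsRatio V x P Q) (hx : x ≠ 0) : V P = V Q := by
  obtain ⟨u, hu, h0, h1⟩ := h.exists_add_eq
  rw [← h1, le_antisymm (not_lt.1 fun h2 => hx (h0.2 h2)) hu, zero_add]

/-- The inequality says that `P / Q - P' / Q'` has positive value, so it vanishes in `Λ(V)`. -/
theorem of_lt (h : IsRatio V x P Q) (hQ' : V Q' ≠ ⊤)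
    (hlt : V Q + V Q' < V (P * Q' - P' * Q)) : IsRatio V x P' Q' := by
  obtain ⟨hQ, ξ, rfl, h1⟩ := h
  have hq := toFrac_ne_zero hQ
  have hq' := toFrac_ne_zero hQ'
  set η : FracField V := ξ - toFrac V P' / toFrac V Q' with hη
  have h2 : η * toFrac V (Q * Q') = toFrac V (P * Q' - P' * Q) := by
    rw [hη, map_sub, map_mul, map_mul, map_mul, ← h1]
    field_simp
  have h3 : frac V η + (V Q + V Q') = V (P * Q' - P' * Q) := by
    rw [← AddValuation.map_mul, ← frac_toFrac V (Q * Q'), ← AddValuation.map_mul, h2, frac_toFrac]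
  have h4 : 0 < frac V η := by
    by_contra! h5
    rw [← h3] at hlt
    exact hlt.not_ge (add_le_of_nonpos_left h5)
  have h5 : η ∈ integers (frac V).toAddValuation := (mem_integers _ _).2 h4.le
  refine ⟨hQ', ξ - ⟨η, h5⟩, ?_, ?_⟩
  · rw [map_sub, (residueMap_eq_zero_iff (frac V) ⟨η, h5⟩).2 h4, sub_zero]
  · have : ((ξ - ⟨η, h5⟩ : integers (frac V).toAddValuation) : FracField V) =
        toFrac V P' / toFrac V Q' := by
      change (ξ : FracField V) - η = _
      rw [hη, sub_sub_cancel]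
    rw [this, div_mul_cancel₀ _ hq']

theorem inv (h : IsRatio V x P Q) (hx : x ≠ 0) : IsRatio V x⁻¹ Q P := by
  have hP := h.eq_of_ne_zero hx
  obtain ⟨hQ, ξ, rfl, h1⟩ := h
  have hu : IsUnit ξ := by
    rw [isUnit_integers_iff]
    exact fun h2 => hx ((residueMap_eq_zero_iff _ _).2 h2)
  obtain ⟨η, hη⟩ := hu.exists_right_inv
  refine ⟨hP ▸ hQ, η, ?_, ?_⟩
  · refine eq_inv_of_mul_eq_one_right ?_
    rw [← map_mul, hη, map_one]
  · have h2 : (ξ : FracField V) * η = 1 := congrArg Subtype.val hη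
    rw [← h1, ← mul_assoc, mul_comm (η : FracField V), h2, one_mul]

theorem sub_reduction (h : IsRatio V x P Q) {g : K[X]} (hg : g ∈ integerRing V) :
    IsRatio V (x - reduction V ⟨g, hg⟩) (P - g * Q) Q := by
  obtain ⟨hQ, ξ, rfl, h1⟩ := h
  refine ⟨hQ, ξ - ⟨toFrac V g, toFrac_mem_integers V hg⟩, ?_, ?_⟩
  · rw [map_sub, reduction_eq]
  · rw [map_sub, map_mul, ← h1]
    exact sub_mul _ _ _

/-- A polynomial relation over the residue field of `K` lifts to numerators and denominators. -/
theorem lt_sum_of_eval₂_eq_zero (h : IsRatio V x P Q) (B : (integers (ordNorm K))[X])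
    (hB : aeval x (B.map (IsLocalRing.residue (integers (ordNorm K)))) = 0) :
    B.natDegree • V Q <
      V (∑ i ∈ Finset.range (B.natDegree + 1),
        C (B.coeff i : K) * P ^ i * Q ^ (B.natDegree - i)) := by
  obtain ⟨hQ, ξ, rfl, h1⟩ := h
  have h2 : residueMap (frac V) (eval₂ (integersMap (frac V)) ξ B) = 0 := by
    rw [aeval_def, eval₂_map] at hB
    rw [hom_eval₂]
    exact hB
  rw [residueMap_eq_zero_iff] at h2
  set T := ∑ i ∈ Finset.range (B.natDegree + 1),
    C (B.coeff i : K) * P ^ i * Q ^ (B.natDegree - i)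
  -- `T` is the homogenised relation, `Q ^ N` times the value of `B` at `P / Q`.
  have h3 : ((eval₂ (integersMap (frac V)) ξ B : integers (frac V).toAddValuation) : FracField V) *
      toFrac V (Q ^ B.natDegree) = toFrac V T := by
    have h4 : ((eval₂ (integersMap (frac V)) ξ B : integers (frac V).toAddValuation) :
        FracField V) = ∑ i ∈ Finset.range (B.natDegree + 1),
          toFrac V (C (B.coeff i : K)) * (ξ : FracField V) ^ i := by
      rw [eval₂_eq_sum_range]
      exact map_sum (integers (frac V).toAddValuation).subtype _ _
    rw [h4, map_sum, Finset.sum_mul]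
    refine Finset.sum_congr rfl fun i hi => ?_
    rw [map_mul, map_mul, map_pow, map_pow, map_pow, ← h1, mul_pow,
      ← pow_mul_pow_sub (toFrac V Q) (Finset.mem_range_succ_iff.1 hi)]
    ring
  rw [← frac_toFrac V T, ← h3, AddValuation.map_mul, frac_toFrac, AddValuation.map_pow]
  have h5 : B.natDegree • V Q ≠ ⊤ := by
    lift V Q to ℝ using hQ with q
    rw [← WithTop.coe_nsmul]
    exact WithTop.coe_ne_top
  have h6 := WithTop.add_lt_add_right h5 h2
  rw [zero_add] at h6
  exact h6

end IsRatio

/-- Take `s` least among the indices where the minimum defining `V P` is attained. The terms before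
it have larger value and may be dropped. What is left is `φ ^ s * P'`, where the constant digit of
`P'` already attains `V P'`. Such a `P'` can serve as a denominator modulo `φ`. -/
theorem IsStage.exists_leading_form {φ : K[X]} {μ : WithTop ℝ} (h : IsStage V φ μ) {P : K[X]}
    (hP : V P ≠ ⊤) : ∃ (s : ℕ) (P' : K[X]), V (φ ^ s) ≠ ⊤ ∧ V (P' %ₘ φ) = V P' ∧
      V (φ ^ s * P') = V P ∧ V P < V (P - φ ^ s * P') := by
  classical
  have hex : ∃ m, V P = V (digit φ P m) + m • μ := h.exists_eq_digit P
  set s := Nat.find hex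
  have hs : V P = V (digit φ P s) + s • μ := Nat.find_spec hex
  have hlow : ∀ m < s, V P < V (digit φ P m) + m • μ := fun m hm =>
    (h.le_digit P m).lt_of_ne (Nat.find_min hex hm)
  have hφs : V (φ ^ s) = s • μ := by rw [AddValuation.map_pow, h.map_key]
  have hsub : V P < V (P - φ ^ s * (P /ₘ φ ^ s)) := by
    have h1 : P - φ ^ s * (P /ₘ φ ^ s) = ∑ i ∈ Finset.range s, digit φ P i * φ ^ i := by
      have := sum_digit_add h.monic P s
      linear_combination -this
    rw [h1]
    refine AddValuation.map_lt_sum _ hP fun m hm => ?_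
    rw [AddValuation.map_mul, AddValuation.map_pow, h.map_key]
    exact hlow m (Finset.mem_range.1 hm)
  have heq : V (φ ^ s * (P /ₘ φ ^ s)) = V P := by
    rw [AddValuation.map_sub_swap] at hsub
    exact AddValuation.map_eq_of_lt_sub _ hsub
  have hfin : V (φ ^ s) ≠ ⊤ := by
    rw [hs, WithTop.add_ne_top] at hP
    rw [hφs]
    exact hP.2
  refine ⟨s, P /ₘ φ ^ s, hfin, ?_, heq, hsub⟩
  have h2 : V (φ ^ s) + V (P /ₘ φ ^ s) = V (φ ^ s) + V ((P /ₘ φ ^ s) %ₘ φ) := by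
    rw [← AddValuation.map_mul, heq, hs, hφs, add_comm]
    rfl
  exact ((WithTop.add_left_inj hfin).1 h2).symm

end Ratio

/-! ### The algebraic closure of `k` in `Λ(V)` -/

section Algebraic

variable {K : Type*} [NontriviallyNormedField K] [IsUltrametricDist K] [CompleteSpace K]

variable {V : KSemivaluation K K[X]} {φ : K[X]} {μ : WithTop ℝ}
  [Fact (Irreducible φ)] [Algebra.IsAlgebraic K (AdjoinRoot φ)]

/-- Solve `g Q ≡ P` modulo `φ` and subtract the reduction of `g`: the new numerator `P - g Q` is
divisible by `φ`. If the difference `x'` were nonzero, an algebraic relation for it would have a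
unit constant term `b₀`. Modulo `φ` the lifted relation is `b₀ Q ^ N`, whose value `N • V Q` is too
small. -/
theorem IsRatio.mem_range_lamHom {x : Lam V} {P Q : K[X]} (h : IsStage V φ μ)
    (hx : IsRatio V x P Q) (halg : IsAlgebraic (BaseResidueField K) x)
    (hQ : V (Q %ₘ φ) = V Q) : x ∈ h.lamHom.range := by
  have hQ0 : Q %ₘ φ ≠ 0 := fun h0 => hx.1 (by rw [← hQ, h0, AddValuation.map_zero])
  obtain ⟨g, hg, hgQ⟩ := h.exists_mul_modByMonic_eq hQ0 (degree_modByMonic_lt Q h.monic)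
    (degree_modByMonic_lt P h.monic)
  have hgmem : g ∈ integerRing V := by
    rw [mem_integerRing]
    -- `V g + V Q = V (P %ₘ φ) ≥ V P ≥ V Q`, and `V Q` is finite.
    have h1 := h.map_mul_modByMonic hg (degree_modByMonic_lt Q h.monic)
    rw [hgQ, hQ] at h1
    have h2 := hx.le.trans (h.le_modByMonic P)
    rw [h1] at h2
    have hfin := hx.1
    clear hQ h1
    revert h2
    generalize V g = u
    intro h2
    lift V Q to ℝ using hfin with q
    induction u with
    | top => exact le_top
    | coe u =>
      rw [← WithTop.coe_add, WithTop.coe_le_coe] at h2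
      rw [← WithTop.coe_zero, WithTop.coe_le_coe]
      linarith
  have hgr := h.reduction_mem_range_lamHom hg hgmem
  have hgalg : IsAlgebraic (BaseResidueField K) (reduction V ⟨g, hgmem⟩) := by
    obtain ⟨y, hy⟩ := hgr
    rw [← hy]
    exact ((isAlgebraic_residueField (AdjoinRoot φ)).isAlgebraic y).algHom h.lamHom
  have hx' := hx.sub_reduction hgmem
  have halg' := halg.sub hgalg
  set x' := x - reduction V ⟨g, hgmem⟩ with hx'def
  suffices hx0 : x' = 0 by
    rw [hx'def, sub_eq_zero] at hx0
    rwa [hx0]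
  by_contra hx0
  have hdvd : φ ∣ P - g * Q := by
    have h1 := modByMonic_add_div P φ
    have h2 := modByMonic_add_div Q φ
    have h3 := modByMonic_add_div (g * (Q %ₘ φ)) φ
    rw [hgQ] at h3
    exact ⟨P /ₘ φ - g * (Q /ₘ φ) - (g * (Q %ₘ φ)) /ₘ φ, by
      linear_combination - h1 + g * h2 + h3⟩
  have hcoeff := minpoly.coeff_zero_ne_zero halg'.isIntegral hx0
  obtain ⟨B, hB⟩ := map_surjective (IsLocalRing.residue (integers (ordNorm K)))
    IsLocalRing.residue_surjective (minpoly (BaseResidueField K) x')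
  have hlt := hx'.lt_sum_of_eval₂_eq_zero B (by rw [hB, minpoly.aeval])
  rw [Finset.sum_range_succ'] at hlt
  set N := B.natDegree
  set T := ∑ i ∈ Finset.range N, C (B.coeff (i + 1) : K) * (P - g * Q) ^ (i + 1) *
    Q ^ (N - (i + 1))
  have hT : φ ∣ T := Finset.dvd_sum fun i _ =>
    ((dvd_pow hdvd i.succ_ne_zero).mul_left _).mul_right _
  rw [pow_zero, mul_one, Nat.sub_zero] at hlt
  have hb0 : ordNorm K (B.coeff 0 : K) = 0 := by
    rw [← hB, coeff_map, Ne, IsLocalRing.residue_eq_zero_iff, IsLocalRing.mem_maximalIdeal,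
      mem_nonunits_iff, not_not, isUnit_integers_iff, not_lt] at hcoeff
    exact le_antisymm hcoeff ((mem_integers _ _).1 (B.coeff 0).2)
  have hmod : V ((T + C (B.coeff 0 : K) * Q ^ N) %ₘ φ) = N • V Q := by
    rw [add_modByMonic, (modByMonic_eq_zero_iff_dvd h.monic).2 hT, zero_add, ← h.rep_mk]
    change h.adjoinRootValuation _ = _
    rw [map_mul, map_pow, AddValuation.map_mul, AddValuation.map_pow]
    have h1 : h.adjoinRootValuation (AdjoinRoot.mk φ Q) = V Q := by
      rw [← hQ, ← h.rep_mk]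
      rfl
    have h2 : h.adjoinRootValuation (AdjoinRoot.mk φ (C (B.coeff 0 : K))) = 0 := by
      rw [AdjoinRoot.mk_C, ← AdjoinRoot.algebraMap_eq, h.adjoinRootValuation.map_algebraMap, hb0]
    rw [h1, h2, zero_add]
  have := h.le_modByMonic (T + C (B.coeff 0 : K) * Q ^ N)
  rw [hmod] at this
  exact this.not_gt hlt

/-- The elements of the residue class field of a stage that are algebraic over the residue field of
`K` come from the residue field of `K[X] / (φ)`. -/
theorem IsStage.mem_range_lamHom_of_isAlgebraic (h : IsStage V φ μ) {x : Lam V}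
    (halg : IsAlgebraic (BaseResidueField K) x) : x ∈ h.lamHom.range := by
  by_cases hx : x = 0
  · rw [hx]
    exact zero_mem _
  obtain ⟨P, Q, hPQ⟩ := exists_isRatio x
  have hVP := hPQ.eq_of_ne_zero hx
  obtain ⟨s, Q', hs, hQ', hsQ, hQ⟩ := h.exists_leading_form hPQ.1
  obtain ⟨t, P', ht, hP', htP, hP⟩ := h.exists_leading_form (hVP ▸ hPQ.1)
  -- The common factor `φ ^ s` cancels from the fraction when the denominator carries the smaller
  -- power of `φ`. Otherwise the argument is applied to `x⁻¹`.
  have key : ∀ {x : Lam V} {P Q P' Q' : K[X]} {s t : ℕ}, IsRatio V x P Q → V P = V Q → s ≤ t →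
      V (φ ^ s) ≠ ⊤ → V (φ ^ s * Q') = V Q → V Q < V (Q - φ ^ s * Q') →
      V P < V (P - φ ^ t * P') → IsRatio V x (φ ^ (t - s) * P') Q' := by
    intro x P Q P' Q' s t hPQ hVP hst hs hsQ hQ hP
    have hfin := hPQ.1
    have hQ'fin : V Q' ≠ ⊤ := by
      have h1 := hfin
      rw [← hsQ, AddValuation.map_mul, WithTop.add_ne_top] at h1
      exact h1.2
    refine hPQ.of_lt hQ'fin ?_
    have h1 : V Q + V Q < V (φ ^ s * (P * Q' - φ ^ (t - s) * P' * Q)) := by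
      have h2 : φ ^ s * (P * Q' - φ ^ (t - s) * P' * Q) =
          Q * (P - φ ^ t * P') - P * (Q - φ ^ s * Q') := by
        rw [← pow_mul_pow_sub φ hst]
        ring
      rw [h2, sub_eq_add_neg]
      apply AddValuation.map_lt_add
      · rw [AddValuation.map_mul]
        exact WithTop.add_lt_add_left hfin (hVP ▸ hP)
      · rw [AddValuation.map_neg, AddValuation.map_mul, hVP]
        exact WithTop.add_lt_add_left hfin hQ
    rw [AddValuation.map_mul] at h1 hsQ
    by_contra! h3
    have h4 := add_le_add_right h3 (V (φ ^ s))
    have h5 : V (φ ^ s) + (V Q + V Q') = V Q + V Q := by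
      rw [← hsQ]
      abel
    rw [h5] at h4
    exact h4.not_gt h1
  rcases le_total s t with hst | hst
  · exact (key hPQ hVP hst hs hsQ hQ hP).mem_range_lamHom h halg hQ'
  · have h1 := (key (hPQ.inv hx) hVP.symm hst ht htP hP hQ).mem_range_lamHom h halg.inv hP'
    obtain ⟨y, hy⟩ := h1
    refine ⟨y⁻¹, ?_⟩
    have h2 : h.lamHom y⁻¹ = (h.lamHom y)⁻¹ := map_inv₀ _ _
    exact h2.trans (by rw [show h.lamHom y = x⁻¹ from hy, inv_inv])

/-- `lamHom` identifies the residue field of `K[X]/(φ)` with the algebraic closure of `k` in `Λ(V)`.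
-/
theorem IsStage.isPurelyInseparable_iff (h : IsStage V φ μ) :
    IsPurelyInseparable (BaseResidueField K)
        (algebraicClosure (BaseResidueField K) (Lam V)) ↔
      IsPurelyInseparable (BaseResidueField K)
        (ResidueField (extendedValuation K (AdjoinRoot φ))) := by
  have halg := isAlgebraic_residueField (K := K) (AdjoinRoot φ)
  rw [isPurelyInseparable_iff_pow_mem (BaseResidueField K) (ringExpChar (BaseResidueField K)),
    isPurelyInseparable_iff_pow_mem (BaseResidueField K) (ringExpChar (BaseResidueField K))]
  constructor
  · intro H y
    obtain ⟨m, c, hc⟩ := H ⟨h.lamHom y, mem_algebraicClosure_iff.2 <| (halg.isAlgebraic y).algHom h.lamHom⟩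
    refine ⟨m, c, h.lamHom.toRingHom.injective ?_⟩
    have h1 : algebraMap _ (Lam V) c = h.lamHom y ^ _ := congrArg Subtype.val hc
    exact (h.lamHom.commutes c).trans (h1.trans (map_pow h.lamHom _ _).symm)
  · rintro H ⟨x, hx⟩
    obtain ⟨y, rfl⟩ := h.mem_range_lamHom_of_isAlgebraic (mem_algebraicClosure_iff.1 hx)
    obtain ⟨m, c, hc⟩ := H y
    refine ⟨m, c, Subtype.ext ?_⟩
    have h1 := congrArg h.lamHom hc
    rw [h.lamHom.commutes, map_pow] at h1
    exact h1

end Algebraic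

/-! ### Relative closeness in an ultrametric field -/

section Near

variable {L : Type*} [NormedField L] [IsUltrametricDist L]

theorem norm_sub_lt_of_lt {x y z : L} {c : ℝ} (h : ‖x - y‖ < c) (h' : ‖y - z‖ < c) :
    ‖x - z‖ < c := by
  rw [← sub_add_sub_cancel x y z]
  exact (IsUltrametricDist.norm_add_le_max _ _).trans_lt (max_lt h h')

theorem norm_eq_of_norm_sub_lt {x y : L} (h : ‖y - x‖ < ‖x‖) : ‖y‖ = ‖x‖ := by
  rw [sub_eq_add_neg] at h
  rw [IsUltrametricDist.norm_eq_of_add_norm_lt_max (h.trans_le (by simp)), norm_neg]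

/-- `‖y - x‖ < ‖x‖` means that `y / x` is a principal unit, and principal units form a group. -/
theorem norm_mul_sub_mul_lt {x y x' y' : L} (h : ‖y - x‖ < ‖x‖) (h' : ‖y' - x'‖ < ‖x'‖) :
    ‖y * y' - x * x'‖ < ‖x * x'‖ := by
  have hx := (norm_nonneg _).trans_lt h
  have hx' := (norm_nonneg _).trans_lt h'
  apply norm_sub_lt_of_lt (y := y * x')
  · rw [← mul_sub, norm_mul, norm_mul, norm_eq_of_norm_sub_lt h]
    exact mul_lt_mul_of_pos_left h' hx
  · rw [← sub_mul, norm_mul, norm_mul]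
    exact mul_lt_mul_of_pos_right h hx'

theorem norm_pow_sub_pow_lt {x y : L} (h : ‖y - x‖ < ‖x‖) (m : ℕ) :
    ‖y ^ m - x ^ m‖ < ‖x ^ m‖ := by
  induction m with
  | zero => simp
  | succ m ih =>
    rw [pow_succ, pow_succ]
    exact norm_mul_sub_mul_lt ih h

theorem norm_prod_sub_prod_lt {ι : Type*} (s : Multiset ι) (u v : ι → L)
    (h : ∀ i ∈ s, ‖v i - u i‖ < ‖u i‖) :
    ‖(s.map v).prod - (s.map u).prod‖ < ‖(s.map u).prod‖ := by
  induction s using Multiset.induction_on with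
  | empty => simp
  | cons i s ih =>
    rw [Multiset.map_cons, Multiset.map_cons, Multiset.prod_cons, Multiset.prod_cons]
    exact norm_mul_sub_mul_lt (h i (Multiset.mem_cons_self i s))
      (ih fun k hk => h k (Multiset.mem_cons_of_mem hk))

theorem norm_coeff_X_sub_C_pow_mul_le (x : L) (n i : ℕ) :
    ‖((X - C x) ^ n).coeff i‖ * ‖x‖ ^ i ≤ ‖x‖ ^ n := by
  rw [sub_eq_add_neg, ← C_neg, coeff_X_add_C_pow]
  by_cases hi : i ≤ n
  · rw [norm_mul, norm_pow, norm_neg, ← pow_sub_mul_pow ‖x‖ hi]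
    have := IsUltrametricDist.norm_natCast_le_one L (n.choose i)
    gcongr
    exact mul_le_of_le_one_right (by positivity) this
  · rw [Nat.choose_eq_zero_of_lt (not_le.1 hi)]
    simp

/-- If all the roots of a monic polynomial are close to `x`, then so is the polynomial to a power of
`X - x`. -/
theorem norm_coeff_prod_sub_mul_lt {x : L} (hx : x ≠ 0) (s : Multiset L)
    (h : ∀ y ∈ s, ‖y - x‖ < ‖x‖) (i : ℕ) :
    ‖((s.map fun y => X - C y).prod - (X - C x) ^ Multiset.card s).coeff i‖ * ‖x‖ ^ i <
      ‖x‖ ^ Multiset.card s := by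
  have hx0 := norm_pos_iff.2 hx
  induction s using Multiset.induction_on generalizing i with
  | empty => simp
  | cons y s ih =>
    have ih' := ih fun z hz => h z (Multiset.mem_cons_of_mem hz)
    have hy := h y (Multiset.mem_cons_self y s)
    rw [Multiset.map_cons, Multiset.prod_cons, Multiset.card_cons]
    set A := (s.map fun y => X - C y).prod
    set n := Multiset.card s
    set B := (X - C x) ^ n with hB
    -- All three terms are estimated in the Gauss norm of radius `‖x‖`: the first two by induction,
    -- the last by `‖y - x‖ < ‖x‖`.
    have h1 : (X - C y) * A - (X - C x) ^ (n + 1) =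
        (X * (A - B) - C y * (A - B)) - C (y - x) * B := by
      rw [pow_succ, ← hB, C_sub]
      ring
    rw [h1, coeff_sub, coeff_sub, coeff_C_mul, coeff_C_mul]
    have hb : ‖(y - x) * B.coeff i‖ * ‖x‖ ^ i < ‖x‖ ^ (n + 1) := by
      rw [norm_mul, mul_assoc, pow_succ']
      exact mul_lt_mul_of_lt_of_le_of_nonneg_of_pos hy (norm_coeff_X_sub_C_pow_mul_le x n i)
        (norm_nonneg _) (pow_pos hx0 n)
    have hc : ‖y * (A - B).coeff i‖ * ‖x‖ ^ i < ‖x‖ ^ (n + 1) := by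
      rw [norm_mul, mul_assoc, pow_succ', norm_eq_of_norm_sub_lt hy]
      exact mul_lt_mul_of_pos_left (ih' i) hx0
    have hd : ‖(X * (A - B)).coeff i‖ * ‖x‖ ^ i < ‖x‖ ^ (n + 1) := by
      cases i with
      | zero => simpa using pow_pos hx0 (n + 1)
      | succ i =>
        rw [coeff_X_mul, pow_succ, pow_succ, ← mul_assoc]
        exact mul_lt_mul_of_pos_right (ih' i) hx0
    rw [← lt_div_iff₀ (pow_pos hx0 i)] at hb hc hd ⊢
    rw [sub_eq_add_neg, sub_eq_add_neg]
    refine (IsUltrametricDist.norm_add_le_max _ _).trans_lt (max_lt ?_ (by rwa [norm_neg]))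
    exact (IsUltrametricDist.norm_add_le_max _ _).trans_lt (max_lt hd (by rwa [norm_neg]))

theorem norm_intCast_eq_one {p : ℕ} (hchar : CharP (BaseResidueField L) p) {b : ℤ}
    (hb : ¬ (p : ℤ) ∣ b) : ‖(b : L)‖ = 1 := by
  have h1 : IsLocalRing.residue (integers (ordNorm L)) (b : integers (ordNorm L)) ≠ 0 := by
    rw [map_intCast, Ne, CharP.intCast_eq_zero_iff (BaseResidueField L) p]
    exact hb
  rw [Ne, IsLocalRing.residue_eq_zero_iff, IsLocalRing.mem_maximalIdeal, mem_nonunits_iff, not_not,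
    isUnit_integers_iff, not_lt] at h1
  have h2 : ((b : integers (ordNorm L)) : L) = b := by simp
  rw [h2, ← AddValuation.map_one (ordNorm L), ordNorm_le_iff, norm_one] at h1
  exact le_antisymm (IsUltrametricDist.norm_intCast_le_one L b) h1

end Near

/-- Lucas's theorem removes a factor `p` from both entries, down to `m.choose 1 = m`. -/
theorem not_dvd_choose_pow {p : ℕ} (hp : p.Prime) {m : ℕ} (hm : ¬ p ∣ m) (k : ℕ) :
    ¬ p ∣ (p ^ k * m).choose (p ^ k) := by
  have : Fact p.Prime := ⟨hp⟩
  induction k with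
  | zero => simpa using hm
  | succ k ih =>
    have h := Choose.choose_modEq_choose_mod_mul_choose_div_nat (p := p) (n := p ^ (k + 1) * m)
      (k := p ^ (k + 1))
    rw [pow_succ', mul_assoc, Nat.mul_mod_right, Nat.mul_mod_right, Nat.mul_div_cancel_left _ hp.pos,
      Nat.mul_div_cancel_left _ hp.pos, Nat.choose_self, one_mul] at h
    rw [pow_succ', mul_assoc]
    rwa [h.dvd_iff dvd_rfl]

theorem algEquiv_aeval {F : Type*} [Field F] (σ : AlgebraicClosure F ≃ₐ[F] AlgebraicClosure F)
    (α : AlgebraicClosure F) (g : F[X]) : σ (aeval α g) = aeval (σ α) g :=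
  (aeval_algHom_apply σ α g).symm

/-- `g(α)` lies in `K(α)`. This bounds the exponents `k` of `exists_norm_pow_sub_lt` uniformly in
`g`. -/
theorem natDegree_minpoly_aeval_le {F : Type*} [Field F] (α : AlgebraicClosure F) (g : F[X]) :
    (minpoly F (aeval α g)).natDegree ≤ (minpoly F α).natDegree := by
  have halg : IsIntegral F α := (Algebra.IsAlgebraic.isAlgebraic α).isIntegral
  have := IntermediateField.adjoin.finiteDimensional halg
  rw [← IntermediateField.adjoin.finrank halg]
  have h1 : aeval α g = algebraMap (IntermediateField.adjoin F {α}) (AlgebraicClosure F)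
      (aeval (IntermediateField.AdjoinSimple.gen F α) g) := by
    rw [← aeval_algebraMap_apply, IntermediateField.AdjoinSimple.algebraMap_gen]
  rw [h1, minpoly.algebraMap_eq (FaithfulSMul.algebraMap_injective _ _)]
  exact minpoly.natDegree_le _

/-! ### Almost Galois-invariant elements -/

section Descent

variable {K : Type*} [NontriviallyNormedField K] [IsUltrametricDist K] [CompleteSpace K]

/-- If all the conjugates of `x` are close to `x`, then some `p`-power power of `x` is close to an
element of `K`. -/
theorem exists_norm_pow_sub_lt {p : ℕ} (hp : p.Prime) (hchar : CharP (BaseResidueField K) p)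
    {x : AlgebraicClosure K}
    (hx : ∀ σ : AlgebraicClosure K ≃ₐ[K] AlgebraicClosure K, ‖σ x - x‖ < ‖x‖) :
    ∃ k ≤ (minpoly K x).natDegree, ∃ a : K,
      ‖algebraMap K (AlgebraicClosure K) a - x ^ p ^ k‖ < ‖x ^ p ^ k‖ := by
  have hx0 : 0 < ‖x‖ := (norm_nonneg _).trans_lt (hx AlgEquiv.refl)
  have halg : IsAlgebraic K x := Algebra.IsAlgebraic.isAlgebraic x
  have hm := minpoly.monic halg.isIntegral
  set P := minpoly K x with hP
  have hn0 : P.natDegree ≠ 0 := (minpoly.natDegree_pos halg.isIntegral).ne'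
  obtain ⟨k, n', hn', hn⟩ := Nat.exists_eq_pow_mul_and_not_dvd hn0 p hp.ne_one
  have hkn : k ≤ P.natDegree := by
    have h1 : k < p ^ k := Nat.lt_pow_self hp.one_lt
    have h2 : p ^ k ≤ P.natDegree := Nat.le_of_dvd (Nat.pos_of_ne_zero hn0) ⟨n', hn⟩
    omega
  have hpk : p ^ k ≤ P.natDegree := Nat.le_of_dvd (Nat.pos_of_ne_zero hn0) ⟨n', hn⟩
  set Q := P.map (algebraMap K (AlgebraicClosure K)) with hQ
  have hsp : Q.Splits := IsAlgClosed.splits Q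
  have hcard : Multiset.card Q.roots = P.natDegree := by
    rw [← hsp.natDegree_eq_card_roots, hQ, natDegree_map]
  have hroots : ∀ y ∈ Q.roots, ‖y - x‖ < ‖x‖ := by
    intro y hy
    have h1 : aeval y P = 0 := by
      rw [hQ] at hy
      exact (mem_aroots'.1 hy).2
    obtain ⟨σ, rfl⟩ := minpoly.exists_algEquiv_of_root' halg h1
    exact hx σ
  -- With `deg P = p ^ k * n'` and `p ∤ n'`, compare the coefficients of degree `deg P - p ^ k` in
  -- `P` and in the power of `X - x`. In the latter it is `(-x) ^ p ^ k` times a binomial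
  -- coefficient prime to `p`, which has norm `1`.
  have h1 := norm_coeff_prod_sub_mul_lt (norm_pos_iff.1 hx0) Q.roots hroots
    (P.natDegree - p ^ k)
  rw [← hsp.eq_prod_roots_of_monic (hm.map _), hcard, coeff_sub, sub_eq_add_neg X, ← C_neg,
    coeff_X_add_C_pow, Nat.sub_sub_self hpk, hQ, coeff_map, Nat.choose_symm hpk,
    ← pow_sub_mul_pow ‖x‖ (Nat.sub_le P.natDegree (p ^ k)), Nat.sub_sub_self hpk] at h1
  have h2 := lt_of_mul_lt_mul_right h1 (by positivity)
  set b : ℤ := (-1) ^ p ^ k * (P.natDegree.choose (p ^ k) : ℤ) with hb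
  have hb1 : ‖(b : AlgebraicClosure K)‖ = 1 := by
    have h3 : ‖(b : K)‖ = 1 := by
      apply norm_intCast_eq_one hchar
      rw [hb, IsUnit.dvd_mul_left (IsUnit.pow _ isUnit_one.neg), Int.natCast_dvd_natCast, hn]
      exact not_dvd_choose_pow hp hn' k
    have h4 : spectralNorm K (AlgebraicClosure K) (algebraMap K (AlgebraicClosure K) (b : K)) =
        ‖(b : K)‖ := spectralNorm_extends _
    rw [← h3, ← h4, map_intCast]
    rfl
  have hb0 : (b : AlgebraicClosure K) ≠ 0 := norm_pos_iff.1 (hb1 ▸ one_pos)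
  refine ⟨k, hkn, P.coeff (P.natDegree - p ^ k) / b, ?_⟩
  have h5 : algebraMap K (AlgebraicClosure K) (P.coeff (P.natDegree - p ^ k) / b) - x ^ p ^ k =
      (algebraMap K (AlgebraicClosure K) (P.coeff (P.natDegree - p ^ k)) -
        (-x) ^ p ^ k * (P.natDegree.choose (p ^ k) : ℕ)) / b := by
    rw [map_div₀, map_intCast, eq_div_iff hb0, sub_mul, div_mul_cancel₀ _ hb0, hb]
    push_cast
    rw [neg_pow x]
    ring
  rw [h5, norm_div, hb1, div_one, norm_pow]
  exact h2

/-- If all roots of `g` are further from `α` than `σ α`, then the values of `g` at `α` and at `σ α`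
are close. -/
theorem norm_aeval_sub_lt {α α' : AlgebraicClosure K} {g : K[X]} (hg : g ≠ 0)
    (h : ∀ γ : AlgebraicClosure K, aeval γ g = 0 → ‖α' - α‖ < ‖α - γ‖) :
    ‖aeval α' g - aeval α g‖ < ‖aeval α g‖ := by
  have hsp := IsAlgClosed.splits (g.map (algebraMap K (AlgebraicClosure K)))
  rw [Splits.aeval_eq_prod_aroots hsp, Splits.aeval_eq_prod_aroots hsp]
  apply norm_mul_sub_mul_lt
  · rw [sub_self, norm_zero, norm_pos_iff]
    simpa using hg
  · refine norm_prod_sub_prod_lt _ _ _ fun γ hγ => ?_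
    -- The factors `α' - γ` and `α - γ` differ by `α' - α`, whatever the root `γ`.
    rw [sub_sub_sub_cancel_right]
    exact h γ (mem_aroots'.1 hγ).2

/-- If `g` has the same value at `α` and `β`, and all conjugates of `α` are closer to `α` than `β`,
then the roots of `g` are further from `α` than the conjugates of `α`. -/
theorem norm_sub_lt_of_root {α β : AlgebraicClosure K} {d : ℕ}
    (hβ : ∀ σ : AlgebraicClosure K ≃ₐ[K] AlgebraicClosure K, ‖σ α - α‖ < ‖β - α‖)
    (hval : ∀ g : K[X], g ≠ 0 → g.natDegree < d → ‖aeval α g‖ = ‖aeval β g‖ ∧ aeval α g ≠ 0)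
    {γ : AlgebraicClosure K} {g : K[X]} (hg0 : g ≠ 0) (hg : g.natDegree < d)
    (hγ : aeval γ g = 0) (σ : AlgebraicClosure K ≃ₐ[K] AlgebraicClosure K) :
    ‖σ α - α‖ < ‖α - γ‖ := by
  by_contra! hlt
  have halg : IsAlgebraic K γ := Algebra.IsAlgebraic.isAlgebraic γ
  have hm := minpoly.monic halg.isIntegral
  -- If `γ` were as close to `α` as `σ α`, every conjugate of `γ` would be closer to `α` than to
  -- `β`. Its minimal polynomial would then be strictly smaller at `α` than at `β`.
  obtain ⟨heq, hne⟩ := hval (minpoly K γ) hm.ne_zero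
    ((natDegree_le_of_dvd (minpoly.dvd K γ hγ) hg0).trans_lt hg)
  have hγβ : ‖α - γ‖ < ‖β - α‖ := hlt.trans_lt (hβ σ)
  have hsp := IsAlgClosed.splits ((minpoly K γ).map (algebraMap K (AlgebraicClosure K)))
  rw [hsp.aeval_eq_prod_aroots_of_monic hm] at heq hne
  rw [hsp.aeval_eq_prod_aroots_of_monic hm] at heq
  set s := (minpoly K γ).aroots (AlgebraicClosure K) with hs
  have hs0 : s ≠ 0 := by
    intro h0
    have : γ ∈ s := (mem_aroots'.2 ⟨(hm.map _).ne_zero, minpoly.aeval K γ⟩)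
    rw [h0] at this
    exact Multiset.notMem_zero _ this
  have hnorm (t : Multiset (AlgebraicClosure K)) : ‖t.prod‖ = (t.map norm).prod :=
    map_multiset_prod (normHom : AlgebraicClosure K →*₀ ℝ) t
  rw [hnorm, hnorm, Multiset.map_map, Multiset.map_map] at heq
  refine (Multiset.prod_map_lt_prod_map hs0 _ _ (fun δ hδ => ?_) fun δ hδ => ?_).ne heq
  · rw [Function.comp_apply, norm_pos_iff]
    intro h0
    exact hne (Multiset.prod_eq_zero (Multiset.mem_map.2 ⟨δ, hδ, h0⟩))
  · obtain ⟨τ, rfl⟩ := minpoly.exists_algEquiv_of_root' halg (mem_aroots'.1 hδ).2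
    have h1 : ‖α - τ γ‖ < ‖β - α‖ := by
      apply norm_sub_lt_of_lt (y := τ α)
      · rw [norm_sub_rev]
        exact hβ τ
      · rwa [← map_sub, norm_algEquiv]
    have h2 : ‖β - τ γ‖ = ‖β - α‖ := by
      apply norm_eq_of_norm_sub_lt
      rwa [sub_sub_sub_cancel_left]
    rw [Function.comp_apply, Function.comp_apply, h2]
    exact h1

end Descent

theorem degree_mul_divByMonic_lt {F : Type*} [Field F] {φ a b : F[X]} (hφ : φ.Monic)
    (ha : a.degree < φ.degree) (hb : b.degree < φ.degree) : ((a * b) /ₘ φ).degree < φ.degree := by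
  by_cases hq : (a * b) /ₘ φ = 0
  · rw [hq, degree_zero, bot_lt_iff_ne_bot]
    exact degree_ne_bot.2 hφ.ne_zero
  have hab : a * b ≠ 0 := fun h => hq (by rw [h, zero_divByMonic])
  apply degree_lt_degree
  rw [natDegree_divByMonic (a * b) hφ, natDegree_mul (left_ne_zero_of_mul hab)
    (right_ne_zero_of_mul hab)]
  have := natDegree_lt_natDegree (left_ne_zero_of_mul hab) ha
  have := natDegree_lt_natDegree (right_ne_zero_of_mul hab) hb
  omega

theorem ordNorm_mem_valueGroup {K : Type*} [NormedField K] [IsUltrametricDist K] {a : K} {r : ℝ}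
    (h : ordNorm K a = r) : r ∈ valueGroup (ordNorm K) :=
  AddSubgroup.subset_closure ⟨a, h⟩

theorem valueGroup_ordNorm_le {K : Type*} [NormedField K] [IsUltrametricDist K] {R : Type*}
    [CommRing R] [Algebra K R] (V : KSemivaluation K R) :
    valueGroup (ordNorm K) ≤ valueGroup V.toAddValuation := by
  refine AddSubgroup.closure_mono ?_
  rintro r ⟨a, ha⟩
  exact ⟨algebraMap K R a, by rw [V.map_algebraMap, ha]⟩

/-- `G` lies between `c ℤ` and `(c / N) ℤ`, and the index of the first in the second is `N`. -/
theorem relIndex_zmultiples_dvd {c : ℝ} (hc : c ≠ 0) {N : ℕ} (hN : N ≠ 0) {G : AddSubgroup ℝ}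
    (hcG : AddSubgroup.zmultiples c ≤ G) (hG : ∀ r ∈ G, N • r ∈ AddSubgroup.zmultiples c) :
    (AddSubgroup.zmultiples c).relIndex G ∣ N := by
  set g := c / N with hg
  have hN' : (N : ℝ) ≠ 0 := by exact_mod_cast hN
  have hg0 : g ≠ 0 := div_ne_zero hc hN'
  have hinj : Function.Injective (zmultiplesHom ℝ g) := by
    intro a b hab
    simpa [hg0] using hab
  have h1 : AddSubgroup.zmultiples c =
      (AddSubgroup.zmultiples (N : ℤ)).map (zmultiplesHom ℝ g) := by
    rw [AddMonoidHom.map_zmultiples]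
    congr 1
    simp [hg]
    field_simp
  have h2 : G ≤ (⊤ : AddSubgroup ℤ).map (zmultiplesHom ℝ g) := by
    intro r hr
    obtain ⟨m, hm⟩ := AddSubgroup.mem_zmultiples_iff.1 (hG r hr)
    refine ⟨m, trivial, ?_⟩
    simp only [zmultiplesHom_apply, zsmul_eq_mul, nsmul_eq_mul] at hm ⊢
    rw [hg]
    field_simp
    linarith
  have h3 := AddSubgroup.relIndex_mul_relIndex _ _ _ hcG h2
  rw [h1, AddSubgroup.relIndex_map_map_of_injective _ _ hinj, AddSubgroup.relIndex_top_right,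
    Int.index_zmultiples, Int.natAbs_natCast, ← h1] at h3
  exact Dvd.intro _ h3

/-! ### Consequences of a root of `φ j` outside the disk -/

section

variable {K : Type*} [NontriviallyNormedField K] [IsUltrametricDist K] [CompleteSpace K]

theorem norm_sub_lt_of_disk {a : CompletedClosure K} {r : WithTop ℝ} {α α' β : AlgebraicClosure K}
    (hα : (α : CompletedClosure K) ∈ disk a r) (hα' : (α' : CompletedClosure K) ∈ disk a r)
    (hβ : (β : CompletedClosure K) ∉ disk a r) : ‖α' - α‖ < ‖β - α‖ := by
  have hα1 : r ≤ ordNorm (CompletedClosure K) (α - a) := hα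
  have hα1' : r ≤ ordNorm (CompletedClosure K) (α' - a) := hα'
  have h1 : r ≤ ordNorm (CompletedClosure K) (α' - α) := by
    rw [← sub_sub_sub_cancel_right _ _ a]
    exact AddValuation.map_le_sub _ hα1' hα1
  have h2 : ordNorm (CompletedClosure K) (β - α) < r := by
    by_contra! h
    apply hβ
    change r ≤ ordNorm (CompletedClosure K) (β - a)
    rw [← sub_add_sub_cancel _ (α : CompletedClosure K) a]
    exact AddValuation.map_le_add _ h hα1
  have h3 := h2.trans_le h1
  rw [ordNorm_lt_iff, ← UniformSpace.Completion.coe_sub, ← UniformSpace.Completion.coe_sub,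
    UniformSpace.Completion.norm_coe, UniformSpace.Completion.norm_coe] at h3
  exact h3

namespace IsApproximants

variable {f : K[X]} {n : ℕ} {V : ℕ → KSemivaluation K K[X]} {φ : ℕ → K[X]} {μ : ℕ → WithTop ℝ}

/-- Values of `K[X]/(φ j)` are values of remainders, on which `V j` and `V (j - 1)` agree. So its
ramification index divides that of `V (j - 1)`. For `j = 1` the polynomial is linear and the index
is `1`. -/
theorem ramificationIndex_dvd (h : IsApproximants f n V φ μ) {j : ℕ} (hj : 1 ≤ j) (hjn : j ≤ n)
    {p : ℕ} (hp : p.Prime)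
    (hram : ∀ l : ℕ, 1 ≤ l → l < j → ∃ m : ℕ, ramificationIndex (V l) = p ^ m)
    [Fact (Irreducible (φ j))] [Algebra.IsAlgebraic K (AdjoinRoot (φ j))] :
    ∃ m : ℕ, ramificationIndex (extendedValuation K (AdjoinRoot (φ j))) = p ^ m := by
  have hs := h.isStage hj hjn
  obtain rfl | ⟨l, hl, rfl⟩ : j = 1 ∨ ∃ l, 1 ≤ l ∧ j = l + 1 := by
    rcases hj.eq_or_lt with rfl | hj
    · exact Or.inl rfl
    · exact Or.inr ⟨j - 1, by omega, by omega⟩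
  · refine ⟨0, ?_⟩
    rw [pow_zero, ramificationIndex, AddSubgroup.relIndex_eq_one, valueGroup,
      AddSubgroup.closure_le]
    rintro r ⟨x, hx⟩
    obtain ⟨a, ha, -⟩ := h.first
    have hd : (hs.rep x).degree < (X - C a).degree := (hs.degree_rep_lt x).trans_eq (by rw [ha])
    rw [hs.extendedValuation_eq, (V 1).apply_of_degree_lt_X_sub_C hd] at hx
    exact ordNorm_mem_valueGroup hx
  · have hle : valueGroup (extendedValuation K (AdjoinRoot (φ (l + 1)))).toAddValuation ≤
        valueGroup (V l).toAddValuation := by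
      refine AddSubgroup.closure_mono ?_
      rintro r ⟨x, hx⟩
      refine ⟨hs.rep x, ?_⟩
      rw [← h.map_succ hl hjn (hs.degree_rep_lt x), ← hs.extendedValuation_eq, hx]
    obtain ⟨m, hm⟩ := hram l hl (Nat.lt_succ_self l)
    have h1 := AddSubgroup.relIndex_mul_relIndex _ _ _
      (valueGroup_ordNorm_le (extendedValuation K (AdjoinRoot (φ (l + 1))))) hle
    obtain ⟨k, -, hk⟩ := (Nat.dvd_prime_pow hp).1 (Dvd.intro _ (h1.trans hm))
    exact ⟨k, hk⟩

/-- Separation: the conjugates of the root `α` of `f` are closer to `α` than any root of the key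
polynomial `φ j`. -/
theorem norm_aeval_sub_lt (h : IsApproximants f n V φ μ) {j : ℕ} (hj : 1 ≤ j)
    (hjn : j < n) {α : AlgebraicClosure K}
    (hα : ∀ g : K[X], V n g = ordNorm (AlgebraicClosure K) (aeval α g))
    (hsep : ∀ β : AlgebraicClosure K, aeval β (φ j) = 0 →
      ∀ σ : AlgebraicClosure K ≃ₐ[K] AlgebraicClosure K, ‖σ α - α‖ < ‖β - α‖)
    {g : K[X]} (hg : g ≠ 0) (hgd : g.degree < (φ j).degree) (m : ℕ)
    (σ : AlgebraicClosure K ≃ₐ[K] AlgebraicClosure K) :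
    ‖σ (aeval α (g * φ j ^ m)) - aeval α (g * φ j ^ m)‖ < ‖aeval α (g * φ j ^ m)‖ := by
  have hs := h.isStage hj hjn.le
  obtain ⟨β, hβ⟩ := IsAlgClosed.exists_aeval_eq_zero (AlgebraicClosure K) (φ j)
    (degree_pos_of_irreducible hs.irreducible).ne'
  have hval : ∀ g : K[X], g ≠ 0 → g.natDegree < (φ j).natDegree →
      ‖aeval α g‖ = ‖aeval β g‖ ∧ aeval α g ≠ 0 := by
    intro g hg hgd
    have hgd' := degree_lt_degree hgd
    have h1 : ordNorm (AlgebraicClosure K) (aeval α g) = V j g := by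
      rw [← hα, h.map_last hj hjn.le hgd']
    refine ⟨?_, ?_⟩
    · rw [← expNeg_ordNorm, ← expNeg_ordNorm, h1, hs.ordNorm_aeval hβ hgd']
    · rw [← AddValuation.ne_top_iff (ordNorm (AlgebraicClosure K)), h1]
      exact hs.ne_top g hg hgd'
  rw [algEquiv_aeval, map_mul, map_mul, map_pow, map_pow]
  apply norm_mul_sub_mul_lt
  · refine MacLane.norm_aeval_sub_lt hg fun γ hγ => ?_
    exact norm_sub_lt_of_root (hsep β hβ) hval hg (natDegree_lt_natDegree hg hgd) hγ σ
  · refine norm_pow_sub_pow_lt (MacLane.norm_aeval_sub_lt hs.monic.ne_zero fun γ hγ => ?_) m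
    rw [norm_sub_rev α γ]
    exact hsep γ hγ σ

set_option synthInstance.maxHeartbeats 200000 in
-- A nonzero residue class of `K[X]/(φ (j + 1))` is represented by some `g` of low degree and value
-- `0`. Each term of its `φ j`-expansion is almost Galois invariant at `α` and has value at least
-- `0`, so `g(α)` is almost invariant and some `g(α) ^ p ^ k` is close to an element of `K`.
theorem isPurelyInseparable_succ (h : IsApproximants f n V φ μ) (hf : f ≠ 0) {j : ℕ} (hj : 1 ≤ j)
    (hjn : j < n) {p : ℕ} (hp : p.Prime) (hchar : CharP (BaseResidueField K) p)
    {α : AlgebraicClosure K}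
    (hα : ∀ g : K[X], V n g = ordNorm (AlgebraicClosure K) (aeval α g))
    (hsep : ∀ β : AlgebraicClosure K, aeval β (φ j) = 0 →
      ∀ σ : AlgebraicClosure K ≃ₐ[K] AlgebraicClosure K, ‖σ α - α‖ < ‖β - α‖) :
    IsPurelyInseparable (BaseResidueField K)
      (algebraicClosure (BaseResidueField K) (Lam (V (j + 1)))) := by
  have hs := h.isStage (i := j + 1) (by omega) hjn
  have hs0 := h.isStage hj hjn.le
  have : Fact (Irreducible (φ (j + 1))) := ⟨hs.irreducible⟩
  have _ := (AdjoinRoot.powerBasis hs.irreducible.ne_zero).finite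
  have : Algebra.IsAlgebraic K (AdjoinRoot (φ (j + 1))) := Algebra.IsAlgebraic.of_finite K _
  have : ExpChar (BaseResidueField K) p := ExpChar.prime hp
  rw [hs.isPurelyInseparable_iff, isPurelyInseparable_iff_pow_mem _ p]
  have hU : ∀ c : K[X], c.degree < (φ (j + 1)).degree → V n c = V (j + 1) c :=
    fun c hc => h.map_last (by omega) hjn hc
  have hU' : ∀ b c : K[X], b.degree < (φ (j + 1)).degree → c.degree < (φ (j + 1)).degree →
      0 ≤ V n b → 0 ≤ V n c → 0 < V n (b * c - (b * c) %ₘ φ (j + 1)) := by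
    intro b c hb hc hb0 hc0
    rw [hU b hb] at hb0
    rw [hU c hc] at hc0
    have h1 := hs.pos_sub_modByMonic hb hc hb0 hc0
    have h2 : b * c - (b * c) %ₘ φ (j + 1) = φ (j + 1) * ((b * c) /ₘ φ (j + 1)) := by
      rw [sub_eq_iff_eq_add', modByMonic_add_div]
    rw [h2, AddValuation.map_mul, hs.map_key] at h1
    rw [h2, AddValuation.map_mul, h.map_last_key hf (by omega) hjn,
      hU _ (degree_mul_divByMonic_lt hs.monic hb hc)]
    exact h1
  intro y
  by_cases hy : y = 0
  · exact ⟨0, 0, by simp [hy]⟩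
  obtain ⟨x, rfl⟩ := residueMap_surjective _ y
  have hx := hs.rep_mem_integerRing hU x
  set g := hs.rep (x : AdjoinRoot (φ (j + 1))) with hg
  have hgd : g.degree < (φ (j + 1)).degree := hs.degree_rep_lt _
  have hg0 : V n g = 0 := by
    refine le_antisymm ?_ hx
    rw [hU g hgd, ← hs.extendedValuation_eq, ← not_lt]
    exact fun h0 => hy ((residueMap_eq_zero_iff _ _).2 h0)
  have hclose : ∀ σ : AlgebraicClosure K ≃ₐ[K] AlgebraicClosure K,
      ‖σ (aeval α g) - aeval α g‖ < ‖aeval α g‖ := by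
    intro σ
    rw [← ordNorm_lt_iff, ← hα, hg0]
    have hsum := sum_digit_natDegree hs0.monic hs0.natDegree_pos g
    conv_rhs => rw [← hsum, map_sum, map_sum, ← Finset.sum_sub_distrib]
    refine AddValuation.map_lt_sum _ WithTop.zero_ne_top fun m _ => ?_
    by_cases hd : digit (φ j) g m = 0
    · rw [hd, zero_mul, map_zero, map_zero, sub_zero, AddValuation.map_zero]
      exact WithTop.coe_lt_top 0
    refine lt_of_le_of_lt ?_ (ordNorm_lt_iff.2 (h.norm_aeval_sub_lt hj hjn hα hsep hd
      (degree_digit_lt hs0.monic g m) m σ))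
    -- Every term has value at least `V j g = V n g = 0`, since `V j` is the minimum over the
    -- expansion.
    rw [← hα, ← hg0, AddValuation.map_mul, AddValuation.map_pow, h.map_last_key hf hj hjn.le,
      h.map_last hj hjn.le (degree_digit_lt hs0.monic g m),
      h.map_last_of_degree_lt_succ hj hjn hgd]
    exact hs0.le_digit g m
  obtain ⟨k, -, b, hb⟩ := exists_norm_pow_sub_lt hp hchar hclose
  have hval : 0 < V n (C b - g ^ p ^ k) := by
    rw [← ordNorm_lt_iff, AddValuation.map_pow, ← hα, hg0, nsmul_zero] at hb
    rw [hα, map_sub, map_pow, aeval_C]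
    exact hb
  have hb0 : 0 ≤ V n (C b) := by
    rw [← sub_add_cancel (C b) (g ^ p ^ k)]
    refine AddValuation.map_le_add _ hval.le ?_
    rw [AddValuation.map_pow, hg0, nsmul_zero]
  have hb1 : b ∈ integers (ordNorm K) := by
    rw [mem_integers, ← (V n).map_C]
    exact hb0
  refine ⟨k, IsLocalRing.residue _ ⟨b, hb1⟩, ?_⟩
  -- The comparison takes place in `Λ(V n)`, where closeness at `α` is equality of classes. A
  -- homomorphism of fields is injective.
  apply (hs.residueHom (V n) hU hU').injective
  rw [hs.residueHom_algebraMap, map_pow, hs.residueHom_residueMap,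
    algebraMap_eq_reduction (V n) ⟨b, hb1⟩ hb0, ← map_pow, ← sub_eq_zero, ← map_sub,
    reduction_eq_zero_iff]
  exact hval

/-- Each finite value of `V j` is attained by a single term `c_m φ_j^m`, which is almost Galois
invariant at `α`. So `p ^ k` times the value lies in `c ℤ`, with `k` bounded by the degree of `α`.
Hence one power `p ^ M` works for the whole value group. -/
theorem ramificationIndex_eq_pow (h : IsApproximants f n V φ μ) (hf : f ≠ 0) {c : ℝ} (hc : 0 < c)
    (hv : valueGroup (ordNorm K) = AddSubgroup.zmultiples c) {j : ℕ} (hj : 1 ≤ j)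
    (hjn : j < n) {p : ℕ} (hp : p.Prime) (hchar : CharP (BaseResidueField K) p)
    {α : AlgebraicClosure K}
    (hα : ∀ g : K[X], V n g = ordNorm (AlgebraicClosure K) (aeval α g))
    (hsep : ∀ β : AlgebraicClosure K, aeval β (φ j) = 0 →
      ∀ σ : AlgebraicClosure K ≃ₐ[K] AlgebraicClosure K, ‖σ α - α‖ < ‖β - α‖) :
    ∃ m : ℕ, ramificationIndex (V j) = p ^ m := by
  have hs := h.isStage hj hjn.le
  set M := (minpoly K α).natDegree
  have key : valueGroup (V j).toAddValuation ≤
      (AddSubgroup.zmultiples c).comap (nsmulAddMonoidHom (p ^ M)) := by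
    rw [valueGroup, AddSubgroup.closure_le]
    rintro r ⟨g, hg⟩
    obtain ⟨m, hm⟩ := hs.exists_eq_digit g
    rw [hg, ← h.map_last hj hjn.le (degree_digit_lt hs.monic g m),
      ← h.map_last_key hf hj hjn.le, ← AddValuation.map_pow, ← AddValuation.map_mul] at hm
    have hd : digit (φ j) g m ≠ 0 := by
      intro hd
      rw [hd, zero_mul, AddValuation.map_zero] at hm
      exact WithTop.coe_ne_top hm
    set t := digit (φ j) g m * φ j ^ m
    obtain ⟨k, hk, b, hb⟩ := exists_norm_pow_sub_lt hp hchar (h.norm_aeval_sub_lt hj hjn hα hsep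
      hd (degree_digit_lt hs.monic g m) m)
    have hkM : k ≤ M := hk.trans (natDegree_minpoly_aeval_le α t)
    have hb1 : ordNorm K b = ((p ^ k • r : ℝ) : WithTop ℝ) := by
      rw [← (V n).map_C, hα, aeval_C, WithTop.coe_nsmul, hm, hα, ← AddValuation.map_pow]
      apply expNeg_strictAnti.injective
      rw [expNeg_ordNorm, expNeg_ordNorm]
      exact norm_eq_of_norm_sub_lt hb
    have hmem := ordNorm_mem_valueGroup hb1
    rw [hv] at hmem
    change p ^ M • r ∈ AddSubgroup.zmultiples c
    rw [← pow_mul_pow_sub p hkM, mul_comm, mul_smul]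
    exact AddSubgroup.nsmul_mem _ hmem _
  have hle := valueGroup_ordNorm_le (V j)
  rw [hv] at hle
  have hdvd := relIndex_zmultiples_dvd hc.ne' (pow_ne_zero M hp.ne_zero) hle key
  obtain ⟨m, -, hm⟩ := (Nat.dvd_prime_pow hp).1 hdvd
  refine ⟨m, ?_⟩
  rw [ramificationIndex, hv, hm]

end IsApproximants

end

end

end MacLane

/-! ### The theorem -/

theorem mainTheorem2 {K : Type*} [NontriviallyNormedField K] [IsUltrametricDist K] [CompleteSpace K]
    (c : ℝ) (hc : 0 < c)
    (hv : MacLane.valueGroup (MacLane.ordNorm K) = AddSubgroup.zmultiples c)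
    (p : ℕ) (hp : p.Prime) (hchar : CharP (MacLane.BaseResidueField K) p)
    (f : Polynomial K) (hf : Irreducible f)
    (a : MacLane.CompletedClosure K) (r : WithTop ℝ)
    (hB : ∀ α : AlgebraicClosure K, Polynomial.aeval α f = 0 →
      (α : MacLane.CompletedClosure K) ∈ MacLane.disk a r)
    (n : ℕ) (V : ℕ → MacLane.KSemivaluation K (Polynomial K)) (φ : ℕ → Polynomial K)
    (μ : ℕ → WithTop ℝ) (hV : MacLane.IsApproximants f n V φ μ)
    (j : ℕ)
    (hj : IsGreatest {i : ℕ | 1 ≤ i ∧ i ≤ n ∧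
      IsPurelyInseparable (MacLane.BaseResidueField K)
        (algebraicClosure (MacLane.BaseResidueField K) (MacLane.Lam (V i))) ∧
      ∀ l : ℕ, 1 ≤ l → l < i → ∃ m : ℕ, MacLane.ramificationIndex (V l) = p ^ m} j) :
    (∀ α : AlgebraicClosure K, Polynomial.aeval α (φ j) = 0 →
      (α : MacLane.CompletedClosure K) ∈ MacLane.disk a r) ∧
    ∃ hφ : Irreducible (φ j),
      haveI : Fact (Irreducible (φ j)) := ⟨hφ⟩
      haveI : Algebra.IsAlgebraic K (AdjoinRoot (φ j)) :=
        haveI := (AdjoinRoot.powerBasis hφ.ne_zero).finite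
        Algebra.IsAlgebraic.of_finite K (AdjoinRoot (φ j))
      MacLane.IsWeaklyTotallyWildlyRamified K (AdjoinRoot (φ j)) := by
  obtain ⟨⟨hj1, hjn, hpi, hram⟩, hmax⟩ := hj
  have hs := hV.isStage hj1 hjn
  refine ⟨?_, hs.irreducible, ?_⟩
  · rcases hjn.eq_or_lt with rfl | hjn'
    · intro β hβ
      refine hB β ?_
      obtain ⟨q, hq⟩ := hV.key_last_dvd
      rw [hq, map_mul, hβ, zero_mul]
    by_contra! hβ
    obtain ⟨β, hβ, hβB⟩ := hβ
    obtain ⟨α, hα, hVα⟩ := hV.last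
    have hroot (σ : AlgebraicClosure K ≃ₐ[K] AlgebraicClosure K) : aeval (σ α) f = 0 := by
      rw [← MacLane.algEquiv_aeval, hα, map_zero]
    have hsep : ∀ β' : AlgebraicClosure K, aeval β' (φ j) = 0 →
        ∀ σ : AlgebraicClosure K ≃ₐ[K] AlgebraicClosure K, ‖σ α - α‖ < ‖β' - α‖ := by
      intro β' hβ' σ
      have halg : IsAlgebraic K β := Algebra.IsAlgebraic.isAlgebraic β
      rw [minpoly.eq_of_irreducible_of_monic hs.irreducible hβ hs.monic] at hβ'
      obtain ⟨τ, rfl⟩ := minpoly.exists_algEquiv_of_root' halg hβ'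
      -- Only the root `β` is known to lie outside the disk. For `β' = τ β` the inequality is
      -- transported by `τ⁻¹`, which keeps the conjugates of `α` inside.
      have h1 := MacLane.norm_sub_lt_of_disk (hB _ (hroot τ.symm)) (hB _ (hroot (σ.trans τ.symm)))
        hβB
      rw [← MacLane.norm_algEquiv τ, ← MacLane.norm_algEquiv τ (β - _)] at h1
      simpa using h1
    have hpi' := hV.isPurelyInseparable_succ hf.ne_zero hj1 hjn' hp hchar hVα hsep
    have hram' := hV.ramificationIndex_eq_pow hf.ne_zero hc hv hj1 hjn' hp hchar hVα hsep
    -- The index `j + 1` satisfies both conditions, so it is at most `j`.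
    have hmem := hmax ⟨by omega, hjn', hpi', fun l hl hlj => by
      rcases (Nat.lt_succ_iff.1 hlj).eq_or_lt with rfl | hlt
      · exact hram'
      · exact hram l hl hlt⟩
    omega
  · have : Fact (Irreducible (φ j)) := ⟨hs.irreducible⟩
    have hfin := (AdjoinRoot.powerBasis hs.irreducible.ne_zero).finite
    have : Algebra.IsAlgebraic K (AdjoinRoot (φ j)) := Algebra.IsAlgebraic.of_finite K _
    refine ⟨hfin, hs.isPurelyInseparable_iff.1 hpi, ?_⟩
    rw [ringChar.eq (MacLane.BaseResidueField K) p]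
    exact hV.ramificationIndex_dvd hj1 hjn hp hram
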